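/- A two-terminal graph is a finite simple undirected graph together with two distinct distinguished vertices $s,t$ (its terminals); two such graphs are isomorphic if there is a graph isomorphism between them that maps the set of terminals onto the set of terminals. For integers $n\ge 2$ and $m\ge 1$ let $T_{n,m}$ be the class of two-terminal graphs with $n$ vertices and $m$ edges, considered up to isomorphism. For a positive integer $d$, $G\in T_{n,m}$ and $\rho\in[0,1]$, let $R_G^d(\rho)$ be the probability that, after each edge of $G$ is independently deleted with probability $\rho$, the remaining spanning subgraph contains a path of length at most $d$ joining $s$ and $t$; that is, $R_G^d(\rho)=\sum_F(1-\rho)^{|F|}\rho^{m-|F|}$, the sum running over all sets $F\subseteq E(G)$ such that the graph $(V(G),F)$ contains such a path. A graph $G\in T_{n,m}$ is a $d$-uniformly most reliable two-terminal graph ($d$-UMRTTG) in $T_{n,m}$ if $R_G^d(\rho)\ge R_{G'}^d(\rho)$ for every $G'\in T_{n,m}$ and every $\rho\in[0,1]$. For $k\ge 3$ and $0\le r\le k-3$ let $A_{k,r}$ be the two-terminal graph with vertices $s,t,v_3,\dots,v_k$ and edge set $\{st\}\cup\{sv_i,\,v_it : 3\le i\le k\}\cup\{v_3v_{3+j} :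 1\le j\le r\}$. For $5\le m\le 2n-3$ let $H_{n,m}$ be the two-terminal graph on $n$ vertices obtained from $A_{(m+2)/2,\,1}$ by adding $n-\frac{m+2}{2}$ isolated vertices if $m$ is even, and from $A_{(m+3)/2,\,0}$ by adding $n-\frac{m+3}{2}$ isolated vertices if $m$ is odd. Theorem. For all integers $n\ge 6$ and $5\le m\le 2n-3$, the graph $H_{n,m}$ is a $3$-UMRTTG in $T_{n,m}$, and every $3$-UMRTTG in $T_{n,m}$ is isomorphic to $H_{n,m}$. -/

import Mathlib

/-- A two-terminal graph: a simple graph with two distinguished (distinct) vertices. -/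
structure TwoTerminalGraph (V : Type*) where
  graph : SimpleGraph V
  s : V
  t : V
  s_ne_t : s ≠ t

namespace TwoTerminalGraph

/-- Isomorphism of two-terminal graphs: a graph isomorphism that preserves the set of terminals. -/
def Isomorphic {V W : Type*} (G : TwoTerminalGraph V) (H : TwoTerminalGraph W) : Prop :=
  ∃ φ : G.graph ≃g H.graph, ({φ G.s, φ G.t} : Set W) = {H.s, H.t}

/-- The spanning subgraph with edge set `F` has a path of length at most `d` joining the
terminals. -/
def IsPathset {V : Type*} (G : TwoTerminalGraph V) (d : ℕ) (F : Finset (Sym2 V)) : Prop :=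
  ∃ p : (SimpleGraph.fromEdgeSet (F : Set (Sym2 V))).Walk G.s G.t, p.IsPath ∧ p.length ≤ d

open scoped Classical in
/-- The `d`-constrained two-terminal reliability at `ρ`: the probability that the set `F` of
surviving edges is a `d`-pathset, when every edge is independently deleted with probability
`ρ`. -/
noncomputable def reliability {V : Type*} [Fintype V] (G : TwoTerminalGraph V) (d : ℕ)
    (ρ : ℝ) : ℝ :=
  ∑ F ∈ G.graph.edgeFinset.powerset with G.IsPathset d F,
    (1 - ρ) ^ F.card * ρ ^ (G.graph.edgeFinset.card - F.card)

/-- The two-terminal graphs on the `n` vertices of `Fin n` with `m` edges. Every isomorphism class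
of two-terminal graphs with `n` vertices and `m` edges has a member here. -/
def T (n m : ℕ) : Set (TwoTerminalGraph (Fin n)) :=
  {G | G.graph.edgeSet.ncard = m}

/-- `G` is a `d`-uniformly most reliable two-terminal graph in `T n m`. -/
def IsUMRTTG (d n m : ℕ) (G : TwoTerminalGraph (Fin n)) : Prop :=
  G ∈ T n m ∧
    ∀ H ∈ T n m, ∀ ρ : ℝ, ρ ∈ Set.Icc (0 : ℝ) 1 → H.reliability d ρ ≤ G.reliability d ρ

/-- The graph `A_{k,r}` with vertices `v_1 = s, v_2 = t, v_3, …, v_k`, where `v_i` is the element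
`i - 1` of `Fin k`. Its edges join `s` and `t` to each other and to every other vertex, and join
`v_3` to `v_{3+j}` for `1 ≤ j ≤ r` (used for `r ≤ k - 3`). -/
def A (k r : ℕ) (hk : 3 ≤ k) : TwoTerminalGraph (Fin k) where
  graph := SimpleGraph.fromRel fun u v : Fin k =>
    u.val = 0 ∨ u.val = 1 ∨ (u.val = 2 ∧ ∃ j : ℕ, 1 ≤ j ∧ j ≤ r ∧ v.val = 2 + j)
  s := ⟨0, by omega⟩
  t := ⟨1, by omega⟩
  s_ne_t := by simp

/-- Add `n - k` isolated vertices to a two-terminal graph on `Fin k`. -/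
def addIsolated {k n : ℕ} (G : TwoTerminalGraph (Fin k)) (h : k ≤ n) :
    TwoTerminalGraph (Fin n) where
  graph := G.graph.map (Fin.castLEEmb h)
  s := Fin.castLEEmb h G.s
  t := Fin.castLEEmb h G.t
  s_ne_t := fun e => G.s_ne_t ((Fin.castLEEmb h).injective e)

/-- The graph `H_{n,m}`, for `5 ≤ m ≤ 2n - 3`: `A_{(m+2)/2,1}` for even `m` and `A_{(m+3)/2,0}` for
odd `m`, with isolated vertices added. -/
def H (n m : ℕ) (hm : 5 ≤ m) (hmn : m + 3 ≤ 2 * n) : TwoTerminalGraph (Fin n) :=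
  if Even m then (A ((m + 2) / 2) 1 (by omega)).addIsolated (by omega)
  else (A ((m + 3) / 2) 0 (by omega)).addIsolated (by omega)

end TwoTerminalGraph

/-!
The failure probability `1 - R` is bounded below for every two-terminal graph with `m` edges, and
the bound is attained exactly by `H n m`.

Write `p = 1 - ρ`. Once the surviving edges at the terminals are known, and provided that no path of
length `1` or `2` survives, every vertex is in one of three states: attached to `s` only (state
`0`), to neither terminal (state `1`), or to `t` only (state `2`). No path of length `3` survives
precisely when every edge away from the terminals that joins a vertex in state `0` to a vertex in
state `2` is deleted. Hence `1 - R` is, up to a factor `ρ` for the edge `st`, the partition function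
`failure` of a spin model with states in `Fin 3` (`one_sub_reliability`).

For the order `0 < 1 < 2` on the states, the weights of this model are log-supermodular
(`stateWeight_mul_le`), so the FKG inequality applies. It gives lower bounds for the effect of
adding edges:

* the star of `j` edges at a vertex adjacent to exactly one terminal multiplies the failure
  probability by at least `1 - p + p (1 - p²) ^ j`, and edges at a vertex adjacent to neither
  terminal have no effect (`failure_le_of_star`);
* an edge between two common neighbours of the terminals multiplies it by at least
  `edgeBound p = 1 - 2 p³ / (1 + p)²`, if all other edges away from the terminals join common
  neighbours as well; this uses negative correlation and the symmetry between the states `0` and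
  `2` (`failure_le_insert`).

Without edges away from the terminals, the failure probability is `(1 - p²) ^ c` for `c` common
neighbours. A pair of edges that forms a path of length `2` between the terminals thus costs
`1 - p²`, while any other way to use edges is worse, as `1 - p² ≤ edgeBound p ^ 2` and
`minFailure_le_star` show. This yields the bound `minFailure_le_one_sub_reliability`. The graph
`H n m` has `⌊(m - 1) / 2⌋` common neighbours, together with one edge between two of them if `m`
is even, and attains it.

For uniqueness it suffices to look at `ρ = 1/2`, where `1 - p² = 3/4 < (8/9)² = edgeBound p ^ 2`.
The strict inequality forces `st` to be an edge, the number of common neighbours to be maximal, and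
the edge that remains for even `m` to join two of them (`exists_isExtremal`); this determines the
graph up to isomorphism.
-/

namespace TwoTerminalGraph

/-! ### The spin model of the vertex states -/

section StateModel

variable {V : Type*}

/-- In the state `σ`, the edge `e` joins a vertex attached to `s` (state `0`) to a vertex attached
to `t` (state `2`). -/
def Cut (σ : V → Fin 3) (e : Sym2 V) : Prop :=
  ∃ u v, e = s(u, v) ∧ σ u = 0 ∧ σ v = 2

theorem cut_mk (σ : V → Fin 3) (u v : V) :
    Cut σ s(u, v) ↔ (σ u = 0 ∧ σ v = 2) ∨ (σ v = 0 ∧ σ u = 2) := by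
  constructor
  · rintro ⟨a, b, h, ha, hb⟩
    rcases Sym2.eq_iff.1 h with ⟨rfl, rfl⟩ | ⟨rfl, rfl⟩
    · exact Or.inl ⟨ha, hb⟩
    · exact Or.inr ⟨ha, hb⟩
  · rintro (⟨h1, h2⟩ | ⟨h1, h2⟩)
    · exact ⟨u, v, rfl, h1, h2⟩
    · exact ⟨v, u, Sym2.eq_swap, h1, h2⟩

open scoped Classical in
/-- The probability that the edge `e` does not complete a path of length `3` in the state `σ`. -/
noncomputable def edgeFactor (p : ℝ) (σ : V → Fin 3) (e : Sym2 V) : ℝ :=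
  if Cut σ e then 1 - p else 1

theorem edgeFactor_nonneg {p : ℝ} (hp1 : p ≤ 1) (σ : V → Fin 3) (e : Sym2 V) :
    0 ≤ edgeFactor p σ e := by
  unfold edgeFactor; split_ifs <;> linarith

theorem edgeFactor_mul_le {p : ℝ} (hp0 : 0 ≤ p) (hp1 : p ≤ 1) (σ τ : V → Fin 3) (e : Sym2 V) :
    edgeFactor p σ e * edgeFactor p τ e ≤ edgeFactor p (σ ⊓ τ) e * edgeFactor p (σ ⊔ τ) e := by
  induction e with | _ u v
  have k1 : ∀ a b : Fin 3, a ⊓ b = 0 ↔ a = 0 ∨ b = 0 := by decide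
  have k2 : ∀ a b : Fin 3, a ⊓ b = 2 ↔ a = 2 ∧ b = 2 := by decide
  have k3 : ∀ a b : Fin 3, a ⊔ b = 0 ↔ a = 0 ∧ b = 0 := by decide
  have k4 : ∀ a b : Fin 3, a ⊔ b = 2 ↔ a = 2 ∨ b = 2 := by decide
  have h1 : Cut (σ ⊓ τ) s(u, v) → Cut σ s(u, v) ∨ Cut τ s(u, v) := by
    simp only [cut_mk, Pi.inf_apply, k1, k2]; tauto
  have h2 : Cut (σ ⊔ τ) s(u, v) → Cut σ s(u, v) ∨ Cut τ s(u, v) := by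
    simp only [cut_mk, Pi.sup_apply, k3, k4]; tauto
  have h3 : Cut (σ ⊓ τ) s(u, v) → Cut (σ ⊔ τ) s(u, v) → Cut σ s(u, v) ∧ Cut τ s(u, v) := by
    simp only [cut_mk, Pi.inf_apply, Pi.sup_apply, k1, k2, k3, k4]; grind
  unfold edgeFactor
  by_cases c1 : Cut σ s(u, v) <;> by_cases c2 : Cut τ s(u, v) <;>
    by_cases c3 : Cut (σ ⊓ τ) s(u, v) <;> by_cases c4 : Cut (σ ⊔ τ) s(u, v) <;>
    simp only [c1, c2, c3, c4, if_true, if_false] <;> first | nlinarith | simp_all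

/-- The probability that a vertex `v` is in state `i`: state `0` means that among the edges `sv`
and `tv` exactly `sv` survives, state `2` that exactly `tv` survives, state `1` that neither does.
Here `X` and `Y` are the sets of neighbours of `s` and of `t`. The case that both edges survive is
left out, so the values need not add up to `1`. -/
def vertexWeight [DecidableEq V] (p : ℝ) (X Y : Finset V) (v : V) (i : Fin 3) : ℝ :=
  (if v ∈ X then (if i = 0 then p else 1 - p) else (if i = 0 then 0 else 1)) *
    (if v ∈ Y then (if i = 2 then p else 1 - p) else (if i = 2 then 0 else 1))

theorem vertexWeight_nonneg [DecidableEq V] {p : ℝ} {X Y : Finset V} (hp0 : 0 ≤ p) (hp1 : p ≤ 1)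
    (v : V) (i : Fin 3) : 0 ≤ vertexWeight p X Y v i := by
  have : 0 ≤ 1 - p := by linarith
  unfold vertexWeight; split_ifs <;> positivity

variable [Fintype V] [DecidableEq V]

/-- The probability that the vertices are in the state `σ` and no edge of `E` completes a path of
length `3`. -/
noncomputable def stateWeight (p : ℝ) (X Y : Finset V) (E : Finset (Sym2 V)) (σ : V → Fin 3) : ℝ :=
  (∏ v, vertexWeight p X Y v (σ v)) * ∏ e ∈ E, edgeFactor p σ e

/-- The probability that no path of length `2` or `3` survives in the two-terminal graph whose
terminals are not adjacent, have neighbourhoods `X` and `Y`, and whose edges away from the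
terminals form the set `E`. -/
noncomputable def failure (p : ℝ) (X Y : Finset V) (E : Finset (Sym2 V)) : ℝ :=
  ∑ σ : V → Fin 3, stateWeight p X Y E σ

variable {p : ℝ} {X Y : Finset V} {E : Finset (Sym2 V)}

theorem stateWeight_nonneg (hp0 : 0 ≤ p) (hp1 : p ≤ 1) (σ : V → Fin 3) :
    0 ≤ stateWeight p X Y E σ :=
  mul_nonneg (Finset.prod_nonneg fun v _ => vertexWeight_nonneg hp0 hp1 v _)
    (Finset.prod_nonneg fun _ _ => edgeFactor_nonneg hp1 _ _)

theorem failure_nonneg (hp0 : 0 ≤ p) (hp1 : p ≤ 1) : 0 ≤ failure p X Y E :=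
  Finset.sum_nonneg fun _ _ => stateWeight_nonneg hp0 hp1 _

theorem stateWeight_union {E' : Finset (Sym2 V)} (h : Disjoint E E') (σ : V → Fin 3) :
    stateWeight p X Y (E ∪ E') σ = stateWeight p X Y E σ * ∏ e ∈ E', edgeFactor p σ e := by
  rw [stateWeight, Finset.prod_union h, ← mul_assoc]; rfl

/-- The weight of the states is log-supermodular for the order `0 < 1 < 2` on the states of each
vertex. -/
theorem stateWeight_mul_le (hp0 : 0 ≤ p) (hp1 : p ≤ 1) (σ τ : V → Fin 3) :
    stateWeight p X Y E σ * stateWeight p X Y E τ ≤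
      stateWeight p X Y E (σ ⊓ τ) * stateWeight p X Y E (σ ⊔ τ) := by
  have hv : (∏ v, vertexWeight p X Y v (σ v)) * ∏ v, vertexWeight p X Y v (τ v) =
      (∏ v, vertexWeight p X Y v ((σ ⊓ τ) v)) * ∏ v, vertexWeight p X Y v ((σ ⊔ τ) v) := by
    rw [← Finset.prod_mul_distrib, ← Finset.prod_mul_distrib]
    refine Finset.prod_congr rfl fun v _ => ?_
    rcases le_total (σ v) (τ v) with h | h
    · simp [h]
    · simp [h, mul_comm]
  have he : (∏ e ∈ E, edgeFactor p σ e) * ∏ e ∈ E, edgeFactor p τ e ≤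
      (∏ e ∈ E, edgeFactor p (σ ⊓ τ) e) * ∏ e ∈ E, edgeFactor p (σ ⊔ τ) e := by
    rw [← Finset.prod_mul_distrib, ← Finset.prod_mul_distrib]
    exact Finset.prod_le_prod
      (fun e _ => mul_nonneg (edgeFactor_nonneg hp1 _ _) (edgeFactor_nonneg hp1 _ _))
      fun e _ => edgeFactor_mul_le hp0 hp1 σ τ e
  unfold stateWeight
  rw [mul_mul_mul_comm, hv]
  have hw : ∀ σ : V → Fin 3, 0 ≤ ∏ v, vertexWeight p X Y v (σ v) := fun σ =>
    Finset.prod_nonneg fun v _ => vertexWeight_nonneg hp0 hp1 v _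
  exact (mul_le_mul_of_nonneg_left he (mul_nonneg (hw _) (hw _))).trans_eq
    (mul_mul_mul_comm _ _ _ _)

/-- Moving `v` from the state `i` to the state `1` only removes obstructions, so the odds of the
state `i` against the state `1` are at most those given by the vertex weights. -/
theorem sum_state_mul_le (hp0 : 0 ≤ p) (hp1 : p ≤ 1) (v : V) (i : Fin 3) {a b : ℝ}
    (hb : 0 ≤ b)
    (h : vertexWeight p X Y v i * a ≤ b * vertexWeight p X Y v 1) :
    (∑ σ : V → Fin 3, stateWeight p X Y E σ * if σ v = i then 1 else 0) * a ≤
      b * ∑ σ : V → Fin 3, stateWeight p X Y E σ * if σ v = 1 then 1 else 0 := by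
  simp only [mul_ite, mul_one, mul_zero, ← Finset.sum_filter]
  rw [Finset.sum_mul, Finset.mul_sum]
  have hre : ∑ σ : V → Fin 3 with σ v = 1, b * stateWeight p X Y E σ =
      ∑ σ : V → Fin 3 with σ v = i, b * stateWeight p X Y E (Function.update σ v 1) := by
    refine Finset.sum_nbij' (fun σ => Function.update σ v i) (fun σ => Function.update σ v 1)
      ?_ ?_ ?_ ?_ ?_
    · simp
    · simp
    · intro σ hσ; simp only [Finset.mem_filter] at hσ; simp [← hσ.2]
    · intro σ hσ; simp only [Finset.mem_filter] at hσ; simp [← hσ.2]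
    · intro σ hσ; simp only [Finset.mem_filter] at hσ; simp [← hσ.2]
  rw [hre]
  refine Finset.sum_le_sum fun σ hσ => ?_
  simp only [Finset.mem_filter] at hσ
  have he : ∏ e ∈ E, edgeFactor p σ e ≤ ∏ e ∈ E, edgeFactor p (Function.update σ v 1) e := by
    refine Finset.prod_le_prod (fun e _ => edgeFactor_nonneg hp1 _ _) fun e _ => ?_
    have : Cut (Function.update σ v 1) e → Cut σ e := by
      rintro ⟨x, y, rfl, hx, hy⟩
      have hxv : x ≠ v := by rintro rfl; simp at hx
      have hyv : y ≠ v := by rintro rfl; simp at hy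
      exact ⟨x, y, rfl, by simpa [hxv] using hx, by simpa [hyv] using hy⟩
    unfold edgeFactor
    split_ifs <;> first | tauto | linarith
  have hv : ∀ τ : V → Fin 3, ∏ w, vertexWeight p X Y w (τ w) =
      vertexWeight p X Y v (τ v) * ∏ w ∈ Finset.univ.erase v, vertexWeight p X Y w (τ w) :=
    fun τ => (Finset.mul_prod_erase _ _ (Finset.mem_univ v)).symm
  have hr : ∏ w ∈ Finset.univ.erase v, vertexWeight p X Y w (Function.update σ v 1 w) =
      ∏ w ∈ Finset.univ.erase v, vertexWeight p X Y w (σ w) :=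
    Finset.prod_congr rfl fun w hw => by
      rw [Function.update_of_ne (Finset.ne_of_mem_erase hw)]
  have hR : 0 ≤ ∏ w ∈ Finset.univ.erase v, vertexWeight p X Y w (σ w) :=
    Finset.prod_nonneg fun _ _ => vertexWeight_nonneg hp0 hp1 _ _
  have hE : 0 ≤ ∏ e ∈ E, edgeFactor p σ e :=
    Finset.prod_nonneg fun _ _ => edgeFactor_nonneg hp1 _ _
  have hv1 := vertexWeight_nonneg (X := X) (Y := Y) hp0 hp1 v 1
  unfold stateWeight
  rw [hv σ, hv (Function.update σ v 1), hr, hσ.2, Function.update_self]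
  calc _ = (vertexWeight p X Y v i * a) *
        ((∏ w ∈ Finset.univ.erase v, vertexWeight p X Y w (σ w)) * ∏ e ∈ E, edgeFactor p σ e) := by
        ring
    _ ≤ (b * vertexWeight p X Y v 1) *
        ((∏ w ∈ Finset.univ.erase v, vertexWeight p X Y w (σ w)) *
          ∏ e ∈ E, edgeFactor p (Function.update σ v 1) e) := by gcongr
    _ = _ := by ring

theorem failure_eq_sum_states (v : V) : failure p X Y E =
    (∑ σ : V → Fin 3, stateWeight p X Y E σ * if σ v = 0 then 1 else 0) +
    (∑ σ : V → Fin 3, stateWeight p X Y E σ * if σ v = 1 then 1 else 0) +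
    ∑ σ : V → Fin 3, stateWeight p X Y E σ * if σ v = 2 then 1 else 0 := by
  unfold failure
  rw [← Finset.sum_add_distrib, ← Finset.sum_add_distrib]
  refine Finset.sum_congr rfl fun σ _ => ?_
  generalize σ v = i
  fin_cases i <;> simp

theorem sum_state_nonneg (hp0 : 0 ≤ p) (hp1 : p ≤ 1) (v : V) (i : Fin 3) :
    0 ≤ ∑ σ : V → Fin 3, stateWeight p X Y E σ * if σ v = i then 1 else 0 :=
  Finset.sum_nonneg fun _ _ => mul_nonneg (stateWeight_nonneg hp0 hp1 _) (by split_ifs <;> simp)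

/-- The events `σ v = 0` and `σ v = 2` have relative weight at most `p`. -/
theorem sum_state_le (hp0 : 0 ≤ p) (hp1 : p ≤ 1) (v : V) (i : Fin 3) (hi : i ≠ 1) :
    ∑ σ : V → Fin 3, stateWeight p X Y E σ * (if σ v = i then 1 else 0) ≤
      p * failure p X Y E := by
  have hw : vertexWeight p X Y v i * (1 - p) ≤ p * vertexWeight p X Y v 1 := by
    have h1 : 0 ≤ p * (1 - p) := mul_nonneg hp0 (by linarith)
    unfold vertexWeight
    fin_cases i <;> simp at hi ⊢ <;> split_ifs <;> nlinarith
  have h := sum_state_mul_le (E := E) hp0 hp1 v i hp0 hw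
  have h0 := sum_state_nonneg (X := X) (Y := Y) (E := E) hp0 hp1 v 0
  have h2 := sum_state_nonneg (X := X) (Y := Y) (E := E) hp0 hp1 v 2
  rw [failure_eq_sum_states v]
  fin_cases i
  · simp only [Fin.zero_eta] at h ⊢; nlinarith
  · simp at hi
  · simp only [Fin.reduceFinMk] at h ⊢; nlinarith

/-- Positive association, in the form used below: lower bounds for the expectations of nonnegative
monotone functions multiply. -/
theorem prod_mul_sum_le_sum_mul_prod {L ι : Type*} [DistribLattice L] [Fintype L] (μ : L → ℝ)
    (hμ0 : 0 ≤ μ) (hμ : ∀ a b, μ a * μ b ≤ μ (a ⊓ b) * μ (a ⊔ b)) (D : Finset ι) (f : ι → L → ℝ)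
    (c : ι → ℝ) (hf0 : ∀ i ∈ D, 0 ≤ f i) (hf : ∀ i ∈ D, Monotone (f i)) (hc : ∀ i ∈ D, 0 ≤ c i)
    (h : ∀ i ∈ D, c i * ∑ a, μ a ≤ ∑ a, μ a * f i a) :
    (∏ i ∈ D, c i) * ∑ a, μ a ≤ ∑ a, μ a * ∏ i ∈ D, f i a := by
  classical
  have hS : 0 ≤ ∑ a, μ a := Finset.sum_nonneg fun a _ => hμ0 a
  induction D using Finset.induction_on with
  | empty => simp
  | insert i D hi ih =>
    have ih' := ih (fun j hj => hf0 j (by simp [hj])) (fun j hj => hf j (by simp [hj]))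
      (fun j hj => hc j (by simp [hj])) (fun j hj => h j (by simp [hj]))
    have hi' := h i (by simp)
    have hci := hc i (by simp)
    have hcD : 0 ≤ ∏ j ∈ D, c j := Finset.prod_nonneg fun j hj => hc j (by simp [hj])
    simp only [Finset.prod_insert hi]
    rcases hS.eq_or_lt with h0 | hpos
    · rw [← h0, mul_zero]
      exact Finset.sum_nonneg fun a _ => mul_nonneg (hμ0 a) (mul_nonneg (hf0 i (by simp) a)
        (Finset.prod_nonneg fun j hj => hf0 j (by simp [hj]) a))
    · have hfkg := fkg (μ := μ) (f := f i) (g := fun a => ∏ j ∈ D, f j a) hμ0 (hf0 i (by simp))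
        (fun a => Finset.prod_nonneg fun j hj => hf0 j (by simp [hj]) a) (hf i (by simp))
        (fun a b hab => Finset.prod_le_prod (fun j hj => hf0 j (by simp [hj]) a)
          fun j hj => hf j (by simp [hj]) hab) hμ
      refine le_of_mul_le_mul_left ?_ hpos
      calc _ = (c i * ∑ a, μ a) * ((∏ j ∈ D, c j) * ∑ a, μ a) := by ring
        _ ≤ (∑ a, μ a * f i a) * ∑ a, μ a * ∏ j ∈ D, f j a :=
          mul_le_mul hi' ih' (mul_nonneg hcD hS) ((mul_nonneg hci hS).trans hi')
        _ ≤ _ := hfkg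

end StateModel

/-! ### Lower bounds for the failure probability -/

section Bounds

variable {V : Type*} {p : ℝ}

theorem edgeFactor_rev (σ : V → Fin 3) (e : Sym2 V) :
    edgeFactor p (fun v => (σ v).rev) e = edgeFactor p σ e := by
  induction e with | _ u v
  have k0 : ∀ a : Fin 3, a.rev = 0 ↔ a = 2 := by decide
  have k2 : ∀ a : Fin 3, a.rev = 2 ↔ a = 0 := by decide
  have : Cut (fun v => (σ v).rev) s(u, v) ↔ Cut σ s(u, v) := by
    simp only [cut_mk, k0, k2]; tauto
  unfold edgeFactor
  split_ifs <;> tauto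

theorem vertexWeight_rev [DecidableEq V] {X Y : Finset V} (v : V) (i : Fin 3) :
    vertexWeight p X Y v i.rev = vertexWeight p Y X v i := by
  have k0 : ∀ a : Fin 3, a.rev = 0 ↔ a = 2 := by decide
  have k2 : ∀ a : Fin 3, a.rev = 2 ↔ a = 0 := by decide
  simp only [vertexWeight, k0, k2, mul_comm]

variable [Fintype V] [DecidableEq V] {X Y : Finset V} {E : Finset (Sym2 V)}

/-- Exchanging the terminals does not change the failure probability. -/
theorem failure_swap : failure p X Y E = failure p Y X E := by
  unfold failure
  refine Finset.sum_nbij' (fun σ v => (σ v).rev) (fun σ v => (σ v).rev) (by simp) (by simp)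
    (by simp) (by simp) fun σ _ => ?_
  simp only [stateWeight, edgeFactor_rev, vertexWeight_rev]

/-- The effect of the edges `D` at a vertex `u` which is not adjacent to `s`: they matter only while
`u` is attached to `t`, and then each of them is harmful with probability at most `p²`. By positive
association the probability that none is harmful is at least `(1 - p²) ^ D.card`. -/
theorem failure_le_of_star_aux (hp0 : 0 ≤ p) (hp1 : p ≤ 1) {u : V} (hu : u ∉ X)
    {D : Finset (Sym2 V)} (hD : ∀ e ∈ D, u ∈ e ∧ ¬ e.IsDiag) (hED : Disjoint E D) :
    failure p X Y E - (1 - (1 - p ^ 2) ^ D.card) *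
      (∑ σ : V → Fin 3, stateWeight p X Y E σ * if σ u = 2 then 1 else 0) ≤
      failure p X Y (E ∪ D) := by
  classical
  -- Once `u` is attached to `t`, the edge `e = uv` is harmless with probability `f e`.
  let f : Sym2 V → (V → Fin 3) → ℝ := fun e σ => if ∃ v, e = s(u, v) ∧ σ v = 0 then 1 - p else 1
  have hf0 : ∀ e, 0 ≤ f e := fun e σ => by
    simp only [f, Pi.zero_apply]; split_ifs <;> linarith
  have hf : ∀ e, Monotone (f e) := fun e σ τ h => by
    have : (∃ v, e = s(u, v) ∧ τ v = 0) → ∃ v, e = s(u, v) ∧ σ v = 0 := by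
      rintro ⟨v, he, hv⟩
      exact ⟨v, he, le_antisymm (hv ▸ h v) (Fin.zero_le _)⟩
    simp only [f]; split_ifs <;> first | exact absurd (this ‹_›) ‹_› | linarith
  have hg0 : 0 ≤ fun σ : V → Fin 3 => if σ u = 2 then (1 : ℝ) else 0 := fun σ => by
    simp only [Pi.zero_apply]; split_ifs <;> norm_num
  have hg : Monotone fun σ : V → Fin 3 => if σ u = 2 then (1 : ℝ) else 0 := fun σ τ h => by
    have : σ u = 2 → τ u = 2 := fun h2 => by
      have h1 := h u
      rw [h2] at h1
      exact le_antisymm (Fin.le_last _) h1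
    simp only
    split_ifs <;> first | tauto | norm_num
  have hμ0 : 0 ≤ stateWeight p X Y E := fun σ => stateWeight_nonneg hp0 hp1 σ
  have hx : 0 ≤ 1 - p ^ 2 := by nlinarith
  have hfe : ∀ e ∈ D, (1 - p ^ 2) * ∑ σ, stateWeight p X Y E σ ≤
      ∑ σ, stateWeight p X Y E σ * f e σ := by
    intro e he
    obtain ⟨v, rfl⟩ := Sym2.mem_iff_exists.1 (hD e he).1
    have huv : u ≠ v := fun h => (hD _ he).2 (by simpa using h)
    have h0 := sum_state_le (X := X) (Y := Y) (E := E) hp0 hp1 v 0 (by decide)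
    have : ∀ σ : V → Fin 3, f s(u, v) σ = 1 - p * if σ v = 0 then 1 else 0 := by
      intro σ
      have : (∃ w, s(u, v) = s(u, w) ∧ σ w = 0) ↔ σ v = 0 := by
        simp [huv.symm]
      simp only [f, this]; split_ifs <;> ring
    have h1 : ∑ σ, stateWeight p X Y E σ * f s(u, v) σ = failure p X Y E -
        p * ∑ σ : V → Fin 3, stateWeight p X Y E σ * if σ v = 0 then 1 else 0 := by
      rw [failure, Finset.mul_sum, ← Finset.sum_sub_distrib]
      refine Finset.sum_congr rfl fun σ _ => ?_
      rw [this]; ring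
    rw [h1, ← failure]
    nlinarith [mul_le_mul_of_nonneg_left h0 hp0]
  have hprod := prod_mul_sum_le_sum_mul_prod (stateWeight p X Y E) hμ0
    (stateWeight_mul_le hp0 hp1) D f (fun _ => 1 - p ^ 2) (fun e _ => hf0 e) (fun e _ => hf e)
    (fun _ _ => hx) hfe
  rw [Finset.prod_const, ← failure] at hprod
  have hfkg := fkg (μ := stateWeight p X Y E) (f := fun σ => if σ u = 2 then 1 else 0)
    (g := fun σ => ∏ e ∈ D, f e σ)
    hμ0 hg0 (fun σ => Finset.prod_nonneg fun e _ => hf0 e σ) hg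
    (fun σ τ h => Finset.prod_le_prod (fun e _ => hf0 e σ) fun e _ => hf e h)
    (stateWeight_mul_le (E := E) (X := X) (Y := Y) hp0 hp1)
  rw [← failure] at hfkg
  have hr0 := sum_state_nonneg (X := X) (Y := Y) (E := E) hp0 hp1 u 2
  have hr := sum_state_le (X := X) (Y := Y) (E := E) hp0 hp1 u 2 (by decide)
  have hP := failure_nonneg (X := X) (Y := Y) (E := E) hp0 hp1
  have hsplit : failure p X Y (E ∪ D) = failure p X Y E -
      (∑ σ : V → Fin 3, stateWeight p X Y E σ * if σ u = 2 then 1 else 0) +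
      ∑ σ : V → Fin 3, stateWeight p X Y E σ * ((if σ u = 2 then 1 else 0) * ∏ e ∈ D, f e σ) := by
    unfold failure
    rw [← Finset.sum_sub_distrib, ← Finset.sum_add_distrib]
    refine Finset.sum_congr rfl fun σ _ => ?_
    rw [stateWeight_union hED]
    have h3 : ∀ i : Fin 3, i = 0 ∨ i = 1 ∨ i = 2 := by decide
    rcases h3 (σ u) with h | h | h
    · have : stateWeight p X Y E σ = 0 := by
        unfold stateWeight
        rw [Finset.prod_eq_zero (Finset.mem_univ u) (by simp [vertexWeight, hu, h]), zero_mul]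
      simp [this]
    · have : ∏ e ∈ D, edgeFactor p σ e = 1 := Finset.prod_eq_one fun e he => by
        obtain ⟨v, rfl⟩ := Sym2.mem_iff_exists.1 (hD e he).1
        simp [edgeFactor, cut_mk, h]
      simp [this, h]
    · have : ∏ e ∈ D, edgeFactor p σ e = ∏ e ∈ D, f e σ := Finset.prod_congr rfl fun e he => by
        obtain ⟨v, rfl⟩ := Sym2.mem_iff_exists.1 (hD e he).1
        have huv : u ≠ v := fun h => (hD _ he).2 (by simpa using h)
        have : (∃ w, s(u, v) = s(u, w) ∧ σ w = 0) ↔ σ v = 0 := by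
          simp [huv.symm]
        simp only [edgeFactor, cut_mk, f, this, h]
        simp
      rw [this, h]; simp
  rw [hsplit]
  rcases hP.eq_or_lt with h0 | hpos
  · rw [← h0, mul_zero] at hr
    have hr' := le_antisymm hr hr0
    have : 0 ≤ ∑ σ : V → Fin 3, stateWeight p X Y E σ *
        ((if σ u = 2 then 1 else 0) * ∏ e ∈ D, f e σ) :=
      Finset.sum_nonneg fun σ _ => mul_nonneg (hμ0 σ) (mul_nonneg (hg0 σ)
        (Finset.prod_nonneg fun e _ => hf0 e σ))
    rw [hr']; linarith
  · have : (1 - p ^ 2) ^ D.card *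
        (∑ σ : V → Fin 3, stateWeight p X Y E σ * if σ u = 2 then 1 else 0) ≤
        ∑ σ : V → Fin 3, stateWeight p X Y E σ * ((if σ u = 2 then 1 else 0) * ∏ e ∈ D, f e σ) := by
      refine le_of_mul_le_mul_left ?_ hpos
      refine le_trans ?_ hfkg
      calc _ = (∑ σ : V → Fin 3, stateWeight p X Y E σ * if σ u = 2 then 1 else 0) *
            ((1 - p ^ 2) ^ D.card * failure p X Y E) := by ring
        _ ≤ _ := mul_le_mul_of_nonneg_left hprod hr0
    linarith

/-- Adding edges at a vertex which is not joined to `s`. If that vertex is joined to `t`, the edges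
and the edge from `t` fail to help with probability at least `1 - p + p (1 - p²) ^ j`. -/
theorem failure_le_of_star_left (hp0 : 0 ≤ p) (hp1 : p ≤ 1) {u : V} (hu : u ∉ X)
    {D : Finset (Sym2 V)} (hD : ∀ e ∈ D, u ∈ e ∧ ¬ e.IsDiag) (hED : Disjoint E D) :
    (if u ∈ Y then 1 - p + p * (1 - p ^ 2) ^ D.card else 1) * failure p X Y E ≤
      failure p X Y (E ∪ D) := by
  refine le_trans ?_ (failure_le_of_star_aux hp0 hp1 hu hD hED)
  have hx1 : (1 - p ^ 2) ^ D.card ≤ 1 := pow_le_one₀ (by nlinarith) (by nlinarith)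
  split_ifs with h
  · have hr := sum_state_le (X := X) (Y := Y) (E := E) hp0 hp1 u 2 (by decide)
    nlinarith [mul_le_mul_of_nonneg_left hr (sub_nonneg.2 hx1)]
  · have : ∑ σ : V → Fin 3, stateWeight p X Y E σ * (if σ u = 2 then 1 else 0) = 0 := by
      refine Finset.sum_eq_zero fun σ _ => ?_
      split_ifs with h2
      · rw [stateWeight, Finset.prod_eq_zero (Finset.mem_univ u)
          (by simp [vertexWeight, h, h2]), zero_mul, zero_mul]
      · rw [mul_zero]
    rw [this]; linarith

theorem failure_le_of_star (hp0 : 0 ≤ p) (hp1 : p ≤ 1) {u : V} (hu : u ∉ X ∩ Y)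
    {D : Finset (Sym2 V)} (hD : ∀ e ∈ D, u ∈ e ∧ ¬ e.IsDiag) (hED : Disjoint E D) :
    (if u ∈ X ∪ Y then 1 - p + p * (1 - p ^ 2) ^ D.card else 1) * failure p X Y E ≤
      failure p X Y (E ∪ D) := by
  by_cases hX : u ∈ X
  · have hY : u ∉ Y := fun h => hu (Finset.mem_inter.2 ⟨hX, h⟩)
    have := failure_le_of_star_left (X := Y) (Y := X) hp0 hp1 hY hD hED
    rw [failure_swap, failure_swap (X := Y)] at this
    simpa [hX] using this
  · simpa [hX] using failure_le_of_star_left (Y := Y) hp0 hp1 hX hD hED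

/-- Adding an edge between two common neighbours of the terminals, when all other edges away from
the terminals join common neighbours too. The events that one end is attached to `s` and the other
one to `t` are negatively correlated, and each has probability at most `p / (1 + p)`, because
the states `0` and `2` are equally likely. -/
theorem failure_le_insert (hp0 : 0 ≤ p) (hp1 : p ≤ 1) (hE : ∀ e ∈ E, ∀ v ∈ e, v ∈ X ∩ Y)
    {e : Sym2 V} (he : ∀ v ∈ e, v ∈ X ∩ Y) (heE : e ∉ E) (hd : ¬ e.IsDiag) :
    (1 - 2 * p ^ 3 / (1 + p) ^ 2) * failure p X Y E ≤ failure p X Y (insert e E) := by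
  classical
  induction e with | _ u v
  let P : Fin 3 → V → ℝ := fun i w =>
    ∑ σ : V → Fin 3, stateWeight p X Y E σ * if σ w = i then 1 else 0
  have hcut : ∀ w ∈ X ∩ Y, P 0 w = P 2 w := by
    intro w hw
    -- Reversing the states of the common neighbours preserves the weights.
    refine Finset.sum_nbij' (fun σ v => if v ∈ X ∩ Y then (σ v).rev else σ v)
      (fun σ v => if v ∈ X ∩ Y then (σ v).rev else σ v) (by simp) (by simp)
      (fun σ _ => by funext v; simp only; split_ifs <;> simp)
      (fun σ _ => by funext v; simp only; split_ifs <;> simp) fun σ _ => ?_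
    have k0 : ∀ a : Fin 3, a.rev = 0 ↔ a = 2 := by decide
    have k2 : ∀ a : Fin 3, a.rev = 2 ↔ a = 0 := by decide
    have hv : ∀ v, vertexWeight p X Y v (if v ∈ X ∩ Y then (σ v).rev else σ v) =
        vertexWeight p X Y v (σ v) := by
      intro v
      split_ifs with h
      · rw [vertexWeight_rev]
        simp only [Finset.mem_inter] at h
        simp only [vertexWeight, h.1, h.2]
      · rfl
    have hc : ∏ e ∈ E, edgeFactor p (fun v => if v ∈ X ∩ Y then (σ v).rev else σ v) e =
        ∏ e ∈ E, edgeFactor p σ e := by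
      refine Finset.prod_congr rfl fun e he => ?_
      rw [← edgeFactor_rev σ]
      induction e with | _ a b
      have ha := hE _ he a (by simp)
      have hb := hE _ he b (by simp)
      simp only [edgeFactor, cut_mk, ha, hb, if_true]
    simp only [stateWeight, hv, hc, hw, if_true, k2]
  have hbound : ∀ w ∈ X ∩ Y, 0 ≤ P 2 w ∧ (1 + p) * P 2 w ≤ p * failure p X Y E := by
    intro w hw
    refine ⟨sum_state_nonneg hp0 hp1 w 2, ?_⟩
    have h1 : P 2 w * (1 - p) ≤ p * P 1 w := sum_state_mul_le hp0 hp1 w 2 hp0 (by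
      simp only [Finset.mem_inter] at hw
      simp [vertexWeight, hw.1, hw.2]; nlinarith)
    have h2 : failure p X Y E = P 0 w + P 1 w + P 2 w := failure_eq_sum_states w
    rw [hcut w hw] at h2
    rw [h2]; linarith
  have huv : u ≠ v := by simpa using hd
  have hu := he u (by simp)
  have hv := he v (by simp)
  have hneg : ∀ a b : V, failure p X Y E * (∑ σ : V → Fin 3, stateWeight p X Y E σ *
      if σ a = 0 ∧ σ b = 2 then 1 else 0) ≤ P 0 a * P 2 b := by
    intro a b
    have h := fkg (μ := stateWeight p X Y E) (f := fun σ => if σ b = 2 then 1 else 0)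
      (g := fun σ => 1 - if σ a = 0 then 1 else 0)
      (fun σ => stateWeight_nonneg hp0 hp1 σ)
      (fun σ => by simp only [Pi.zero_apply]; split_ifs <;> norm_num)
      (fun σ => by simp only [Pi.zero_apply]; split_ifs <;> norm_num)
      (fun σ τ h => by
        have : σ b = 2 → τ b = 2 := fun h2 => by
          have h1 := h b
          rw [h2] at h1
          exact le_antisymm (Fin.le_last _) h1
        simp only
        split_ifs <;> first | tauto | norm_num)
      (fun σ τ h => by
        have : τ a = 0 → σ a = 0 := fun h2 => le_antisymm (h2 ▸ h a) (Fin.zero_le _)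
        simp only
        split_ifs <;> first | tauto | norm_num)
      (stateWeight_mul_le hp0 hp1)
    have e1 : ∑ σ : V → Fin 3, stateWeight p X Y E σ * (1 - if σ a = 0 then 1 else 0) =
        failure p X Y E - P 0 a := by
      simp only [P, failure, mul_sub, mul_one, Finset.sum_sub_distrib]
    have e2 : ∑ σ : V → Fin 3, stateWeight p X Y E σ *
        ((if σ b = 2 then 1 else 0) * (1 - if σ a = 0 then 1 else 0)) =
        P 2 b - ∑ σ : V → Fin 3, stateWeight p X Y E σ * if σ a = 0 ∧ σ b = 2 then 1 else 0 := by
      simp only [P]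
      rw [← Finset.sum_sub_distrib]
      refine Finset.sum_congr rfl fun σ _ => ?_
      by_cases h1 : σ a = 0 <;> by_cases h2 : σ b = 2 <;> simp [h1, h2]
    rw [e1, e2, ← failure] at h
    change P 2 b * _ ≤ _ at h
    linarith
  have hsum : failure p X Y (insert s(u, v) E) = failure p X Y E -
      p * ((∑ σ : V → Fin 3, stateWeight p X Y E σ * if σ u = 0 ∧ σ v = 2 then 1 else 0) +
        ∑ σ : V → Fin 3, stateWeight p X Y E σ * if σ v = 0 ∧ σ u = 2 then 1 else 0) := by
    unfold failure
    rw [← Finset.sum_add_distrib, Finset.mul_sum, ← Finset.sum_sub_distrib]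
    refine Finset.sum_congr rfl fun σ _ => ?_
    rw [stateWeight, Finset.prod_insert heE, mul_left_comm, ← stateWeight]
    simp only [edgeFactor, cut_mk]
    by_cases h1 : σ u = 0 ∧ σ v = 2
    · simp [h1]; ring
    · by_cases h2 : σ v = 0 ∧ σ u = 2
      · simp [h2]; ring
      · simp [h1, h2]
  have hP := failure_nonneg (X := X) (Y := Y) (E := E) hp0 hp1
  have q1 := hneg u v
  have q2 := hneg v u
  rw [hcut u hu] at q1
  rw [hcut v hv] at q2
  obtain ⟨hu0, hu1⟩ := hbound u hu
  obtain ⟨hv0, hv1⟩ := hbound v hv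
  have hle : (1 + p) ^ 2 * (P 2 u * P 2 v) ≤ p ^ 2 * failure p X Y E ^ 2 := by
    have := mul_le_mul hu1 hv1 (mul_nonneg (by linarith) hv0) (mul_nonneg hp0 hP)
    linarith
  rw [hsum]
  set S := (∑ σ : V → Fin 3, stateWeight p X Y E σ * if σ u = 0 ∧ σ v = 2 then (1 : ℝ) else 0) +
        ∑ σ : V → Fin 3, stateWeight p X Y E σ * if σ v = 0 ∧ σ u = 2 then (1 : ℝ) else 0 with hS
  have hSle : (1 + p) ^ 2 * S ≤ 2 * p ^ 2 * failure p X Y E := by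
    rcases hP.eq_or_lt with h0 | hpos
    · have : S ≤ failure p X Y E := by
        rw [hS, ← Finset.sum_add_distrib]
        refine Finset.sum_le_sum fun σ _ => ?_
        rw [← mul_add]
        refine mul_le_of_le_one_right (stateWeight_nonneg hp0 hp1 σ) ?_
        by_cases h1 : σ u = 0 <;> by_cases h2 : σ v = 0 <;> simp [h1, h2] <;> split_ifs <;> norm_num
      rw [← h0] at this ⊢
      nlinarith [sq_nonneg (1 + p)]
    · refine le_of_mul_le_mul_left ?_ hpos
      have : failure p X Y E * S ≤ 2 * (P 2 u * P 2 v) := by rw [hS, mul_add]; linarith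
      nlinarith [mul_le_mul_of_nonneg_left this (sq_nonneg (1 + p))]
  have h1p : 0 < (1 + p) ^ 2 := by positivity
  have : S ≤ 2 * p ^ 2 / (1 + p) ^ 2 * failure p X Y E := by
    rw [div_mul_eq_mul_div, le_div_iff₀ h1p]; linarith
  have h3 := mul_le_mul_of_nonneg_left this hp0
  have : 2 * p ^ 3 / (1 + p) ^ 2 = p * (2 * p ^ 2 / (1 + p) ^ 2) := by ring
  rw [this]; linarith

theorem failure_empty : failure p X Y ∅ = (1 - p ^ 2) ^ (X ∩ Y).card := by
  have h : failure p X Y ∅ = ∏ v, ∑ i, vertexWeight p X Y v i := by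
    simp only [failure, stateWeight, Finset.prod_empty, mul_one, Finset.prod_univ_sum,
      Fintype.piFinset_univ]
  rw [h, ← Finset.prod_const, ← Finset.prod_subset (Finset.subset_univ (X ∩ Y))]
  · refine Finset.prod_congr rfl fun v hv => ?_
    simp only [Finset.mem_inter] at hv
    simp [Fin.sum_univ_three, vertexWeight, hv.1, hv.2]; ring
  · intro v _ hv
    by_cases hX : v ∈ X <;> by_cases hY : v ∈ Y <;>
      simp_all [Fin.sum_univ_three, vertexWeight]

/-- The lower bound on the failure probability. The terminals have `c` common neighbours, each of
which contributes `1 - p²`; each remaining edge counts as one unit of `g`, and a supermultiplicative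
`g` collects the contributions of the stars at the other vertices and of the edges between common
neighbours. -/
theorem le_failure (hp0 : 0 ≤ p) (hp1 : p ≤ 1) (g : ℕ → ℝ) (hg0 : ∀ a, 0 ≤ g a)
    (hg : ∀ a b, g (a + b) ≤ g a * g b) (hg1 : ∀ a, g a ≤ 1)
    (hedge : g 1 ≤ 1 - 2 * p ^ 3 / (1 + p) ^ 2)
    (hstar : ∀ j, g (j + 1) ≤ 1 - p + p * (1 - p ^ 2) ^ j)
    (hE : ∀ e ∈ E, ¬ e.IsDiag) :
    (1 - p ^ 2) ^ (X ∩ Y).card * g ((X ∪ Y).card - (X ∩ Y).card + E.card) ≤ failure p X Y E := by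
  classical
  have key : ∀ D : Finset (Sym2 V), (∀ e ∈ D, ∀ v ∈ e, v ∈ X ∩ Y) → (∀ e ∈ D, ¬ e.IsDiag) →
      (1 - p ^ 2) ^ (X ∩ Y).card * g D.card ≤ failure p X Y D := by
    intro D
    induction D using Finset.induction_on with
    | empty =>
      intro _ _
      rw [failure_empty]
      exact mul_le_of_le_one_right (pow_nonneg (by nlinarith) _) (hg1 _)
    | insert e D he ih =>
      intro h1 h2
      have h := ih (fun e' h' => h1 e' (by simp [h'])) fun e' h' => h2 e' (by simp [h'])
      refine le_trans ?_ (failure_le_insert hp0 hp1 (fun e' h' => h1 e' (by simp [h']))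
        (h1 e (by simp)) he (h2 e (by simp)))
      rw [Finset.card_insert_of_notMem he, add_comm]
      calc _ ≤ (1 - p ^ 2) ^ (X ∩ Y).card * (g 1 * g D.card) :=
            mul_le_mul_of_nonneg_left (hg _ _) (pow_nonneg (by nlinarith) _)
        _ = g 1 * ((1 - p ^ 2) ^ (X ∩ Y).card * g D.card) := by ring
        _ ≤ _ := mul_le_mul hedge h (mul_nonneg (pow_nonneg (by nlinarith) _) (hg0 _))
          ((hg0 1).trans hedge)
  have star : ∀ S : Finset V, (∀ v ∈ S, v ∉ X ∩ Y) →
      g ((S ∩ (X ∪ Y)).card + (E.filter fun e => ∃ v ∈ S, v ∈ e).card) *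
        failure p X Y (E.filter fun e => ¬ ∃ v ∈ S, v ∈ e) ≤ failure p X Y E := by
    intro S
    induction S using Finset.induction_on with
    | empty =>
      intro _
      simpa using mul_le_of_le_one_left (failure_nonneg hp0 hp1) (hg1 0)
    | insert u S hu ih =>
      intro hS
      have h := ih fun v hv => hS v (by simp [hv])
      refine le_trans ?_ h
      -- The edges at `u` which have not been dealt with yet.
      set D := E.filter fun e => u ∈ e ∧ ¬ ∃ v ∈ S, v ∈ e with hD
      set E' := E.filter fun e => ¬ ∃ v ∈ insert u S, v ∈ e with hE'
      have hdis : Disjoint E' D := by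
        rw [Finset.disjoint_left]
        intro e h1 h2
        simp only [hE', hD, Finset.mem_filter] at h1 h2
        exact h1.2 ⟨u, by simp, h2.2.1⟩
      have hun : E' ∪ D = E.filter fun e => ¬ ∃ v ∈ S, v ∈ e := by
        ext e
        simp only [hE', hD, Finset.mem_union, Finset.mem_filter, Finset.exists_mem_insert]
        generalize (∃ v ∈ S, v ∈ e) = Q
        tauto
      have hcard : (E.filter fun e => ∃ v ∈ insert u S, v ∈ e).card =
          D.card + (E.filter fun e => ∃ v ∈ S, v ∈ e).card := by
        rw [← Finset.card_union_of_disjoint]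
        · congr 1
          ext e
          simp only [hD, Finset.mem_union, Finset.mem_filter, Finset.exists_mem_insert]
          generalize (∃ v ∈ S, v ∈ e) = Q
          tauto
        · rw [Finset.disjoint_left]
          intro e h1 h2
          simp only [hD, Finset.mem_filter] at h1 h2
          exact h1.2.2 h2.2
      have hst := failure_le_of_star (E := E') hp0 hp1 (hS u (by simp)) (D := D)
        (fun e he => by
          simp only [hD, Finset.mem_filter] at he
          exact ⟨he.2.1, hE e he.1⟩) hdis
      rw [hun] at hst
      have hF := failure_nonneg (X := X) (Y := Y) (E := E') hp0 hp1
      have hu' : g ((insert u S ∩ (X ∪ Y)).card + (E.filter fun e => ∃ v ∈ insert u S, v ∈ e).card)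
          ≤ g ((S ∩ (X ∪ Y)).card + (E.filter fun e => ∃ v ∈ S, v ∈ e).card) *
            (if u ∈ X ∪ Y then 1 - p + p * (1 - p ^ 2) ^ D.card else 1) := by
        rw [hcard]
        split_ifs with hxy
        · rw [Finset.insert_inter_of_mem hxy, Finset.card_insert_of_notMem (by simp [hu])]
          have : (S ∩ (X ∪ Y)).card + 1 + (D.card + (E.filter fun e => ∃ v ∈ S, v ∈ e).card) =
            ((S ∩ (X ∪ Y)).card + (E.filter fun e => ∃ v ∈ S, v ∈ e).card) + (D.card + 1) := by ring
          rw [this]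
          exact (hg _ _).trans (mul_le_mul_of_nonneg_left (hstar _) (hg0 _))
        · rw [Finset.insert_inter_of_notMem hxy]
          have : (S ∩ (X ∪ Y)).card + (D.card + (E.filter fun e => ∃ v ∈ S, v ∈ e).card) =
            ((S ∩ (X ∪ Y)).card + (E.filter fun e => ∃ v ∈ S, v ∈ e).card) + D.card := by ring
          rw [this]
          exact (hg _ _).trans (mul_le_mul_of_nonneg_left (hg1 _) (hg0 _))
      calc _ ≤ _ := mul_le_mul_of_nonneg_right hu' hF
        _ = _ := mul_assoc _ _ _
        _ ≤ _ := mul_le_mul_of_nonneg_left hst (hg0 _)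
  have h1 := star (X ∩ Y)ᶜ fun v hv => Finset.mem_compl.1 hv
  set E' := E.filter fun e => ¬ ∃ v ∈ (X ∩ Y)ᶜ, v ∈ e with hE'
  have h2 := key E' (fun e he v hv => by
      simp only [hE', Finset.mem_filter, not_exists, not_and] at he
      by_contra h
      exact he.2 v (Finset.mem_compl.2 h) hv)
    fun e he => hE e (Finset.mem_filter.1 he).1
  have hsub : X ∩ Y ⊆ X ∪ Y := fun v hv => Finset.mem_union_left _ (Finset.mem_inter.1 hv).1
  have hc1 : ((X ∩ Y)ᶜ ∩ (X ∪ Y)).card = (X ∪ Y).card - (X ∩ Y).card := by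
    rw [← Finset.card_sdiff_of_subset hsub]
    congr 1; ext v; simp only [Finset.mem_inter, Finset.mem_compl, Finset.mem_sdiff]; tauto
  have hc2 := Finset.card_filter_add_card_filter_not (s := E) (fun e => ∃ v ∈ (X ∩ Y)ᶜ, v ∈ e)
  rw [hc1] at h1
  rw [← hc2, ← add_assoc]
  calc _ ≤ (1 - p ^ 2) ^ (X ∩ Y).card *
        (g ((X ∪ Y).card - (X ∩ Y).card + (E.filter fun e => ∃ v ∈ (X ∩ Y)ᶜ, v ∈ e).card) *
          g E'.card) := mul_le_mul_of_nonneg_left (hg _ _) (pow_nonneg (by nlinarith) _)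
    _ = g ((X ∪ Y).card - (X ∩ Y).card + (E.filter fun e => ∃ v ∈ (X ∩ Y)ᶜ, v ∈ e).card) *
          ((1 - p ^ 2) ^ (X ∩ Y).card * g E'.card) := by ring
    _ ≤ _ := mul_le_mul_of_nonneg_left h2 (hg0 _)
    _ ≤ _ := h1

end Bounds

/-! ### Reliability in terms of the vertex states -/

section Reliability

variable {V : Type*} [Fintype V]

open scoped Classical in
/-- The neighbours of `s` other than `t`. -/
noncomputable def sNbrs (G : TwoTerminalGraph V) : Finset V :=
  Finset.univ.filter fun v => G.graph.Adj G.s v ∧ v ≠ G.t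

open scoped Classical in
/-- The neighbours of `t` other than `s`. -/
noncomputable def tNbrs (G : TwoTerminalGraph V) : Finset V :=
  Finset.univ.filter fun v => G.graph.Adj G.t v ∧ v ≠ G.s

open scoped Classical in
/-- The edges which are not incident with a terminal. -/
noncomputable def innerEdges (G : TwoTerminalGraph V) : Finset (Sym2 V) :=
  Finset.univ.filter fun e => e ∈ G.graph.edgeSet ∧ G.s ∉ e ∧ G.t ∉ e

variable {G : TwoTerminalGraph V}

theorem mem_sNbrs {v : V} : v ∈ G.sNbrs ↔ G.graph.Adj G.s v ∧ v ≠ G.t := by simp [sNbrs]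

theorem mem_tNbrs {v : V} : v ∈ G.tNbrs ↔ G.graph.Adj G.t v ∧ v ≠ G.s := by simp [tNbrs]

theorem mem_innerEdges {e : Sym2 V} :
    e ∈ G.innerEdges ↔ e ∈ G.graph.edgeSet ∧ G.s ∉ e ∧ G.t ∉ e := by simp [innerEdges]

open scoped Classical in
/-- The edges of a two-terminal graph are `st`, the other edges at `s`, the other edges at `t`, and
the inner edges. -/
theorem prod_edgeFinset {M : Type*} [CommMonoid M] (g : Sym2 V → M) :
    ∏ e ∈ G.graph.edgeFinset, g e = (if G.graph.Adj G.s G.t then g s(G.s, G.t) else 1) *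
      (∏ v ∈ G.sNbrs, g s(G.s, v)) * (∏ v ∈ G.tNbrs, g s(G.t, v)) * ∏ e ∈ G.innerEdges, g e := by
  have hst := G.s_ne_t
  have hE : G.graph.edgeFinset = (((if G.graph.Adj G.s G.t then {s(G.s, G.t)} else ∅) ∪
      G.sNbrs.image fun v => s(G.s, v)) ∪ G.tNbrs.image fun v => s(G.t, v)) ∪ G.innerEdges := by
    ext e
    simp only [SimpleGraph.mem_edgeFinset, Finset.mem_union, Finset.mem_image, mem_sNbrs,
      mem_tNbrs, mem_innerEdges]
    constructor
    · intro he
      by_cases hs : G.s ∈ e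
      · obtain ⟨v, rfl⟩ := Sym2.mem_iff_exists.1 hs
        have he' : G.graph.Adj G.s v := he
        by_cases hv : v = G.t
        · subst hv; simp [he']
        · exact Or.inl (Or.inl (Or.inr ⟨v, ⟨he', hv⟩, rfl⟩))
      · by_cases ht : G.t ∈ e
        · obtain ⟨v, rfl⟩ := Sym2.mem_iff_exists.1 ht
          have he' : G.graph.Adj G.t v := he
          exact Or.inl (Or.inr ⟨v, ⟨he', by rintro rfl; simp at hs⟩, rfl⟩)
        · exact Or.inr ⟨he, hs, ht⟩
    · rintro (((h | ⟨v, h, rfl⟩) | ⟨v, h, rfl⟩) | h)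
      · split_ifs at h with h'
        · rw [Finset.mem_singleton.1 h]; exact h'
        · simp at h
      · exact h.1
      · exact h.1
      · exact h.1
  rw [hE, Finset.prod_union, Finset.prod_union, Finset.prod_union, Finset.prod_image,
    Finset.prod_image]
  · congr 3
    split_ifs <;> simp
  · intro a _ b _ h; exact Sym2.congr_right.1 h
  · intro a _ b _ h; exact Sym2.congr_right.1 h
  · rw [Finset.disjoint_left]
    intro e h1 h2
    obtain ⟨v, hv, rfl⟩ := Finset.mem_image.1 h2
    rw [mem_sNbrs] at hv
    split_ifs at h1
    · simp [hv.2, hst] at h1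
    · simp at h1
  · rw [Finset.disjoint_left]
    intro e h1 h2
    obtain ⟨v, hv, rfl⟩ := Finset.mem_image.1 h2
    rw [mem_tNbrs] at hv
    rcases Finset.mem_union.1 h1 with h1 | h1
    · split_ifs at h1
      · simp [hv.2, hst.symm] at h1
      · simp at h1
    · obtain ⟨w, hw, h⟩ := Finset.mem_image.1 h1
      rcases Sym2.eq_iff.1 h with h | h
      · exact hst h.1
      · exact hv.2 h.1.symm
  · rw [Finset.disjoint_left]
    intro e h1 h2
    rw [mem_innerEdges] at h2
    simp only [Finset.mem_union, Finset.mem_image] at h1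
    rcases h1 with (h1 | ⟨v, _, rfl⟩) | ⟨v, _, rfl⟩
    · split_ifs at h1
      · rw [Finset.mem_singleton.1 h1] at h2; simp at h2
      · simp at h1
    · simp at h2
    · simp at h2

open scoped Classical in
theorem card_edgeFinset : G.graph.edgeFinset.card =
    (if G.graph.Adj G.s G.t then 1 else 0) + G.sNbrs.card + G.tNbrs.card + G.innerEdges.card := by
  have h := prod_edgeFinset (G := G) fun _ => 2
  simp only [Finset.prod_const] at h
  apply Nat.pow_right_injective le_rfl
  simp only
  rw [h, pow_add, pow_add, pow_add]
  congr 3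
  split_ifs <;> rfl

theorem isPathset_three_iff {F : Finset (Sym2 V)} (hF : ∀ e ∈ F, ¬ e.IsDiag) :
    G.IsPathset 3 F ↔ s(G.s, G.t) ∈ F ∨ (∃ v, s(G.s, v) ∈ F ∧ s(G.t, v) ∈ F) ∨
      ∃ u v, s(G.s, u) ∈ F ∧ s(u, v) ∈ F ∧ s(G.t, v) ∈ F := by
  classical
  have hadj : ∀ a b, (SimpleGraph.fromEdgeSet (F : Set (Sym2 V))).Adj a b ↔ s(a, b) ∈ F := by
    intro a b
    rw [SimpleGraph.fromEdgeSet_adj, Finset.mem_coe]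
    exact ⟨fun h => h.1, fun h => ⟨h, fun hab => hF _ h (by simpa using hab)⟩⟩
  constructor
  · rintro ⟨p, -, hp⟩
    have key : ∀ {a b : V} (q : (SimpleGraph.fromEdgeSet (F : Set (Sym2 V))).Walk a b),
        q.length ≤ 3 → a ≠ b → s(a, b) ∈ F ∨ (∃ v, s(a, v) ∈ F ∧ s(b, v) ∈ F) ∨
          ∃ u v, s(a, u) ∈ F ∧ s(u, v) ∈ F ∧ s(b, v) ∈ F := by
      intro a b q hq hab
      match q with
      | .nil => exact absurd rfl hab
      | .cons h .nil => exact Or.inl ((hadj _ _).1 h)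
      | .cons h (.cons h' .nil) =>
        exact Or.inr (Or.inl ⟨_, (hadj _ _).1 h, by rw [Sym2.eq_swap]; exact (hadj _ _).1 h'⟩)
      | .cons h (.cons h' (.cons h'' .nil)) =>
        exact Or.inr (Or.inr ⟨_, _, (hadj _ _).1 h, (hadj _ _).1 h',
          by rw [Sym2.eq_swap]; exact (hadj _ _).1 h''⟩)
      | .cons _ (.cons _ (.cons _ (.cons _ _))) =>
        simp only [SimpleGraph.Walk.length_cons] at hq; omega
    exact key p hp G.s_ne_t
  · have key : ∀ q : (SimpleGraph.fromEdgeSet (F : Set (Sym2 V))).Walk G.s G.t, q.length ≤ 3 →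
        G.IsPathset 3 F := fun q hq =>
      ⟨q.bypass, q.bypass_isPath, q.length_bypass_le_length.trans hq⟩
    rintro (h | ⟨v, h, h'⟩ | ⟨u, v, h, h', h''⟩)
    · exact key (.cons ((hadj _ _).2 h) .nil) (by simp)
    · rw [Sym2.eq_swap] at h'
      exact key (.cons ((hadj _ _).2 h) (.cons ((hadj _ _).2 h') .nil)) (by simp)
    · rw [Sym2.eq_swap] at h''
      exact key (.cons ((hadj _ _).2 h) (.cons ((hadj _ _).2 h') (.cons ((hadj _ _).2 h'') .nil)))
        (by simp)

theorem pow_card_mul_pow_eq_prod {α R : Type*} [DecidableEq α] [CommMonoid R] {s F : Finset α}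
    (h : F ⊆ s) (a b : R) :
    a ^ F.card * b ^ (s.card - F.card) = ∏ e ∈ s, if e ∈ F then a else b := by
  rw [Finset.prod_ite, Finset.prod_const, Finset.prod_const, Finset.filter_mem_eq_inter,
    Finset.inter_eq_right.2 h, ← Finset.sdiff_eq_filter, Finset.card_sdiff_of_subset h]

open scoped Classical in
/-- The state of the vertices when `F` is the set of surviving edges, for an `F` which does not
contain a path of length `2` between the terminals. -/
noncomputable def stateOf (G : TwoTerminalGraph V) (F : Finset (Sym2 V)) (v : V) : Fin 3 :=
  if s(G.s, v) ∈ F then 0 else if s(G.t, v) ∈ F then 2 else 1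

/-- The probability that no path of length at most `3` survives, expressed by the states of the
vertices. -/
theorem one_sub_reliability [DecidableEq V] (ρ : ℝ) [Decidable (G.graph.Adj G.s G.t)] :
    1 - G.reliability 3 ρ = (if G.graph.Adj G.s G.t then ρ else 1) *
      failure (1 - ρ) G.sNbrs G.tNbrs G.innerEdges := by
  classical
  have hst := G.s_ne_t
  have hEd : ∀ F ⊆ G.graph.edgeFinset, ∀ e ∈ F, ¬ e.IsDiag := fun F hF e he =>
    SimpleGraph.not_isDiag_of_mem_edgeSet _ (SimpleGraph.mem_edgeFinset.1 (hF he))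
  have hone : ∑ F ∈ G.graph.edgeFinset.powerset,
      (1 - ρ) ^ F.card * ρ ^ (G.graph.edgeFinset.card - F.card) = 1 := by
    rw [Finset.sum_pow_mul_eq_add_pow]; simp
  have hfail : 1 - G.reliability 3 ρ = ∑ F ∈ G.graph.edgeFinset.powerset with ¬ G.IsPathset 3 F,
      (1 - ρ) ^ F.card * ρ ^ (G.graph.edgeFinset.card - F.card) := by
    have hR : G.reliability 3 ρ = ∑ F ∈ G.graph.edgeFinset.powerset with G.IsPathset 3 F,
        (1 - ρ) ^ F.card * ρ ^ (G.graph.edgeFinset.card - F.card) := by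
      unfold reliability; congr!
    rw [← Finset.sum_filter_add_sum_filter_not _ (fun F => G.IsPathset 3 F)] at hone
    linarith
  -- The sum over the inner edges that survive, for given states of the vertices.
  let term : (V → Fin 3) × Finset (Sym2 V) → ℝ := fun q =>
    (if G.graph.Adj G.s G.t then ρ else 1) *
      ((∏ v, vertexWeight (1 - ρ) G.sNbrs G.tNbrs v (q.1 v)) *
        ((∏ e ∈ q.2, if Cut q.1 e then 0 else 1 - ρ) * ∏ e ∈ G.innerEdges \ q.2, ρ))
  have hrhs : (if G.graph.Adj G.s G.t then ρ else 1) *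
      failure (1 - ρ) G.sNbrs G.tNbrs G.innerEdges =
      ∑ q ∈ (Finset.univ : Finset (V → Fin 3)) ×ˢ G.innerEdges.powerset, term q := by
    rw [Finset.sum_product, failure, Finset.mul_sum]
    refine Finset.sum_congr rfl fun σ _ => ?_
    simp only [term]
    rw [← Finset.mul_sum, ← Finset.mul_sum,
      ← Finset.prod_add (fun e => if Cut σ e then 0 else 1 - ρ) fun _ => ρ, stateWeight]
    congr 2
    refine Finset.prod_congr rfl fun e _ => ?_
    unfold edgeFactor
    split_ifs <;> ring
  have hgood : ∀ F, F ∈ (G.graph.edgeFinset.powerset.filter fun F => ¬ G.IsPathset 3 F) ↔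
      F ⊆ G.graph.edgeFinset ∧ s(G.s, G.t) ∉ F ∧ (∀ v, s(G.s, v) ∈ F → s(G.t, v) ∉ F) ∧
        ∀ u v, s(G.s, u) ∈ F → s(u, v) ∈ F → s(G.t, v) ∉ F := by
    intro F
    rw [Finset.mem_filter, Finset.mem_powerset]
    refine and_congr_right fun hF => ?_
    rw [isPathset_three_iff (hEd F hF)]
    push Not
    rfl
  have hstate0 : ∀ F v, G.stateOf F v = 0 ↔ s(G.s, v) ∈ F := by
    intro F v; unfold stateOf; split_ifs <;> simp_all
  have hstate2 : ∀ F, (∀ v, s(G.s, v) ∈ F → s(G.t, v) ∉ F) → ∀ v,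
      (G.stateOf F v = 2 ↔ s(G.t, v) ∈ F) := by
    intro F hF v; have := hF v; unfold stateOf; split_ifs <;> simp_all
  rw [hfail, hrhs]
  refine Finset.sum_of_injOn (fun F => (G.stateOf F, G.innerEdges.filter (· ∈ F))) ?_ ?_ ?_ ?_
  · intro F₁ h₁ F₂ h₂ h
    rw [Finset.mem_coe, hgood] at h₁ h₂
    simp only [Prod.mk.injEq] at h
    have hs : ∀ v, s(G.s, v) ∈ F₁ ↔ s(G.s, v) ∈ F₂ := fun v => by
      rw [← hstate0, ← hstate0, h.1]
    have ht : ∀ v, s(G.t, v) ∈ F₁ ↔ s(G.t, v) ∈ F₂ := fun v => by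
      rw [← hstate2 _ h₁.2.2.1, ← hstate2 _ h₂.2.2.1, h.1]
    have hall : ∀ e ∈ G.graph.edgeFinset, e ∈ F₁ ↔ e ∈ F₂ := by
      intro e he
      by_cases hse : G.s ∈ e
      · obtain ⟨v, rfl⟩ := Sym2.mem_iff_exists.1 hse
        exact hs v
      by_cases hte : G.t ∈ e
      · obtain ⟨v, rfl⟩ := Sym2.mem_iff_exists.1 hte
        exact ht v
      have hin : e ∈ G.innerEdges := mem_innerEdges.2 ⟨SimpleGraph.mem_edgeFinset.1 he, hse, hte⟩
      have := Finset.ext_iff.1 h.2 e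
      simpa [hin] using this
    ext e
    exact ⟨fun he => (hall e (h₁.1 he)).1 he, fun he => (hall e (h₂.1 he)).2 he⟩
  · intro F _
    exact Finset.mem_coe.2 (Finset.mem_product.2
      ⟨Finset.mem_univ _, Finset.mem_powerset.2 (Finset.filter_subset _ _)⟩)
  · rintro ⟨σ, F'⟩ hq hnot
    by_contra hne
    refine hnot ?_
    simp only [Finset.mem_product, Finset.mem_univ, true_and, Finset.mem_powerset] at hq
    have hne1 := right_ne_zero_of_mul hne
    have hw := Finset.prod_ne_zero_iff.1 (left_ne_zero_of_mul hne1)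
    have hc := Finset.prod_ne_zero_iff.1 (left_ne_zero_of_mul (right_ne_zero_of_mul hne1))
    have hX : ∀ v, σ v = 0 → v ∈ G.sNbrs := fun v h => by
      by_contra h'
      exact hw v (Finset.mem_univ v) (by simp [vertexWeight, h, h'])
    have hY : ∀ v, σ v = 2 → v ∈ G.tNbrs := fun v h => by
      by_contra h'
      exact hw v (Finset.mem_univ v) (by simp [vertexWeight, h, h'])
    have hcut : ∀ e ∈ F', ¬ Cut σ e := fun e he h => hc e he (by simp [h])
    have hin : ∀ e ∈ F', e ∈ G.graph.edgeSet ∧ G.s ∉ e ∧ G.t ∉ e := fun e he =>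
      mem_innerEdges.1 (hq he)
    set F := F' ∪ ((Finset.univ.filter fun v => σ v = 0).image fun v => s(G.s, v)) ∪
      ((Finset.univ.filter fun v => σ v = 2).image fun v => s(G.t, v)) with hF
    have hmem : ∀ e, e ∈ F ↔
        (e ∈ F' ∨ ∃ v, σ v = 0 ∧ s(G.s, v) = e) ∨ ∃ v, σ v = 2 ∧ s(G.t, v) = e := by
      intro e; simp [hF, or_assoc]
    have hFs : ∀ v, s(G.s, v) ∈ F ↔ σ v = 0 := by
      intro v
      rw [hmem]
      constructor
      · rintro ((h | ⟨w, hw, h⟩) | ⟨w, hw, h⟩)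
        · exact absurd (Sym2.mem_mk_left _ _) (hin _ h).2.1
        · rw [← Sym2.congr_right.1 h]; exact hw
        · rcases Sym2.eq_iff.1 h with h | h
          · exact absurd h.1.symm hst
          · exact absurd h.2 (mem_tNbrs.1 (hY w hw)).2
      · exact fun h => Or.inl (Or.inr ⟨v, h, rfl⟩)
    have hFt : ∀ v, s(G.t, v) ∈ F ↔ σ v = 2 := by
      intro v
      rw [hmem]
      constructor
      · rintro ((h | ⟨w, hw, h⟩) | ⟨w, hw, h⟩)
        · exact absurd (Sym2.mem_mk_left _ _) (hin _ h).2.2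
        · rcases Sym2.eq_iff.1 h with h | h
          · exact absurd h.1 hst
          · exact absurd h.2 (mem_sNbrs.1 (hX w hw)).2
        · rw [← Sym2.congr_right.1 h]; exact hw
      · exact fun h => Or.inr ⟨v, h, rfl⟩
    have hσ : ∀ v, σ v = 0 → σ v ≠ 2 := fun v h => by rw [h]; decide
    have hσs : σ G.s = 1 := by
      have h3 : ∀ i : Fin 3, i ≠ 0 → i ≠ 2 → i = 1 := by decide
      exact h3 _ (fun h => (mem_sNbrs.1 (hX _ h)).1.ne rfl) fun h => (mem_tNbrs.1 (hY _ h)).2 rfl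
    have hσt : σ G.t = 1 := by
      have h3 : ∀ i : Fin 3, i ≠ 0 → i ≠ 2 → i = 1 := by decide
      exact h3 _ (fun h => (mem_sNbrs.1 (hX _ h)).2 rfl) fun h => (mem_tNbrs.1 (hY _ h)).1.ne rfl
    refine ⟨F, ?_, ?_⟩
    · rw [Finset.mem_coe, hgood]
      refine ⟨fun e he => ?_, ?_, ?_, ?_⟩
      · rw [SimpleGraph.mem_edgeFinset]
        rcases (hmem e).1 he with (h | ⟨w, hw, rfl⟩) | ⟨w, hw, rfl⟩
        · exact (hin e h).1
        · exact (mem_sNbrs.1 (hX w hw)).1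
        · exact (mem_tNbrs.1 (hY w hw)).1
      · rw [hFs, hσt]; decide
      · intro v h1 h2
        exact hσ v ((hFs v).1 h1) ((hFt v).1 h2)
      · intro u v h1 h2 h3
        have hu := (hFs u).1 h1
        have hv := (hFt v).1 h3
        rcases (hmem _).1 h2 with (h | ⟨w, hw, h⟩) | ⟨w, hw, h⟩
        · exact hcut _ h ⟨u, v, rfl, hu, hv⟩
        · rcases Sym2.eq_iff.1 h with h | h
          · rw [← h.1, hσs] at hu; exact absurd hu (by decide)
          · rw [← h.1, hσs] at hv; exact absurd hv (by decide)
        · rcases Sym2.eq_iff.1 h with h | h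
          · rw [← h.1, hσt] at hu; exact absurd hu (by decide)
          · rw [← h.1, hσt] at hv; exact absurd hv (by decide)
    · refine Prod.ext (funext fun v => ?_) ?_
      · simp only [stateOf, hFs, hFt]
        generalize σ v = i
        fin_cases i <;> rfl
      · ext e
        simp only [Finset.mem_filter]
        constructor
        · rintro ⟨h1, h2⟩
          have h1' := mem_innerEdges.1 h1
          rcases (hmem e).1 h2 with (h | ⟨w, hw, rfl⟩) | ⟨w, hw, rfl⟩
          · exact h
          · exact absurd (Sym2.mem_mk_left _ _) h1'.2.1
          · exact absurd (Sym2.mem_mk_left _ _) h1'.2.2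
        · exact fun h => ⟨hq h, (hmem e).2 (Or.inl (Or.inl h))⟩
  · intro F hF
    rw [hgood] at hF
    obtain ⟨hsub, h1, h2, h3⟩ := hF
    have hs : ∀ v, v ∉ G.sNbrs → s(G.s, v) ∉ F := fun v hv h => hv (mem_sNbrs.2
      ⟨SimpleGraph.mem_edgeFinset.1 (hsub h), by rintro rfl; exact h1 h⟩)
    have ht : ∀ v, v ∉ G.tNbrs → s(G.t, v) ∉ F := fun v hv h => hv (mem_tNbrs.2
      ⟨SimpleGraph.mem_edgeFinset.1 (hsub h), by
        rintro rfl; rw [Sym2.eq_swap] at h; exact h1 h⟩)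
    rw [pow_card_mul_pow_eq_prod hsub, prod_edgeFinset, mul_assoc, mul_assoc]
    simp only [term, h1, if_false]
    congr 1
    rw [← mul_assoc]
    congr 1
    · simp only [vertexWeight, Finset.prod_mul_distrib, hstate0, hstate2 F h2]
      congr 1
      · rw [← Finset.prod_subset (Finset.subset_univ G.sNbrs)]
        · exact Finset.prod_congr rfl fun v hv => by simp [hv]
        · intro v _ hv; simp [hv, hs v hv]
      · rw [← Finset.prod_subset (Finset.subset_univ G.tNbrs)]
        · exact Finset.prod_congr rfl fun v hv => by simp [hv]
        · intro v _ hv; simp [hv, ht v hv]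
    · rw [Finset.prod_ite, ← Finset.filter_not]
      congr 1
      refine Finset.prod_congr rfl fun e he => ?_
      rw [if_neg]
      rintro ⟨u, v, rfl, hu, hv⟩
      exact h3 u v ((hstate0 F u).1 hu) (Finset.mem_filter.1 he).2 ((hstate2 F h2 v).1 hv)

end Reliability

/-! ### The optimal value -/

section Optimum

/-- The factor by which a single edge between two common neighbours of the terminals multiplies the
failure probability, see `failure_singleton`. -/
noncomputable def edgeBound (p : ℝ) : ℝ := 1 - 2 * p ^ 3 / (1 + p) ^ 2

/-- The lower bound for the failure probability of a graph with `M` edges in which `st` is not an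
edge. For even `M` and for odd `M ≥ 5` it is attained by `M / 2` common neighbours of the terminals,
with an edge between two of them if `M` is odd. -/
noncomputable def minFailure (p : ℝ) (M : ℕ) : ℝ :=
  (1 - p ^ 2) ^ (M / 2) * edgeBound p ^ (M % 2)

variable {p : ℝ}

theorem one_sub_le_edgeBound (hp0 : 0 ≤ p) (hp1 : p ≤ 1) : 1 - p ≤ edgeBound p := by
  have h : 2 * p ^ 3 / (1 + p) ^ 2 ≤ p := by
    rw [div_le_iff₀ (by positivity)]
    nlinarith [mul_nonneg hp0 hp0, mul_nonneg hp0 (sub_nonneg.2 hp1),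
      mul_nonneg (mul_nonneg hp0 hp0) (sub_nonneg.2 hp1)]
  unfold edgeBound; linarith

theorem edgeBound_le_one (hp0 : 0 ≤ p) : edgeBound p ≤ 1 := by
  have : 0 ≤ 2 * p ^ 3 / (1 + p) ^ 2 := by positivity
  unfold edgeBound; linarith

theorem one_sub_sq_le_edgeBound_sq (hp0 : 0 ≤ p) : 1 - p ^ 2 ≤ edgeBound p ^ 2 := by
  have h1 : (1 + p) ≠ 0 := by positivity
  have h : edgeBound p ^ 2 - (1 - p ^ 2) =
      p ^ 2 * ((1 - p ^ 2) ^ 2 + 4 * p ^ 4) / (1 + p) ^ 4 := by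
    unfold edgeBound; field_simp; ring
  have : 0 ≤ p ^ 2 * ((1 - p ^ 2) ^ 2 + 4 * p ^ 4) / (1 + p) ^ 4 := by positivity
  linarith

theorem minFailure_add_two (M : ℕ) : minFailure p (M + 2) = (1 - p ^ 2) * minFailure p M := by
  unfold minFailure
  rw [Nat.add_mod_right, Nat.add_div_right _ (by norm_num), pow_succ]; ring

theorem minFailure_two_mul_add (c k : ℕ) :
    minFailure p (2 * c + k) = (1 - p ^ 2) ^ c * minFailure p k := by
  induction c with
  | zero => simp
  | succ c ih =>
    rw [show 2 * (c + 1) + k = 2 * c + k + 2 by ring, minFailure_add_two, ih]; ring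

theorem minFailure_zero : minFailure p 0 = 1 := by simp [minFailure]

theorem minFailure_one : minFailure p 1 = edgeBound p := by simp [minFailure]

theorem minFailure_nonneg (hp0 : 0 ≤ p) (hp1 : p ≤ 1) (M : ℕ) : 0 ≤ minFailure p M :=
  mul_nonneg (pow_nonneg (by nlinarith) _)
    (pow_nonneg (by linarith [one_sub_le_edgeBound hp0 hp1]) _)

theorem minFailure_le_one (hp0 : 0 ≤ p) (hp1 : p ≤ 1) (M : ℕ) : minFailure p M ≤ 1 := by
  have h1 : (1 - p ^ 2) ^ (M / 2) ≤ 1 := pow_le_one₀ (by nlinarith) (by nlinarith)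
  have h0 : 0 ≤ edgeBound p := by linarith [one_sub_le_edgeBound hp0 hp1]
  have h2 : edgeBound p ^ (M % 2) ≤ 1 := pow_le_one₀ h0 (edgeBound_le_one hp0)
  exact mul_le_one₀ h1 (pow_nonneg h0 _) h2

theorem minFailure_add_le (hp0 : 0 ≤ p) (hp1 : p ≤ 1) (a b : ℕ) :
    minFailure p (a + b) ≤ minFailure p a * minFailure p b := by
  have hx : 0 ≤ 1 - p ^ 2 := by nlinarith
  have key : ∀ i < 2, ∀ j < 2, minFailure p (i + j) ≤ minFailure p i * minFailure p j := by
    intro i hi j hj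
    interval_cases i <;> interval_cases j
    · simp [minFailure_zero]
    · simp [minFailure_zero]
    · simp [minFailure_zero]
    · have h := minFailure_add_two (p := p) 0
      rw [minFailure_zero, mul_one] at h
      rw [show 1 + 1 = 0 + 2 by norm_num, h, minFailure_one, ← sq]
      exact one_sub_sq_le_edgeBound_sq hp0
  have h := key (a % 2) (Nat.mod_lt _ (by norm_num)) (b % 2) (Nat.mod_lt _ (by norm_num))
  have ha := minFailure_two_mul_add (p := p) (a / 2) (a % 2)
  have hb := minFailure_two_mul_add (p := p) (b / 2) (b % 2)
  have hab := minFailure_two_mul_add (p := p) (a / 2 + b / 2) (a % 2 + b % 2)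
  rw [Nat.div_add_mod] at ha hb
  rw [show 2 * (a / 2 + b / 2) + (a % 2 + b % 2) = a + b by omega] at hab
  rw [ha, hb, hab, pow_add]
  calc _ ≤ (1 - p ^ 2) ^ (a / 2) * (1 - p ^ 2) ^ (b / 2) *
        (minFailure p (a % 2) * minFailure p (b % 2)) :=
        mul_le_mul_of_nonneg_left h (mul_nonneg (pow_nonneg hx _) (pow_nonneg hx _))
    _ = _ := by ring

/-- A star of `j` edges at a vertex adjacent to one terminal, with the edge to that terminal, is no
better than `j + 1` edges used optimally. -/
theorem minFailure_le_star (hp0 : 0 ≤ p) (hp1 : p ≤ 1) (j : ℕ) :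
    minFailure p (j + 1) ≤ 1 - p + p * (1 - p ^ 2) ^ j := by
  have hx : 0 ≤ 1 - p ^ 2 := by nlinarith
  have hx1 : 1 - p ^ 2 ≤ 1 := by nlinarith
  have key : ∀ j, minFailure p (j + 2) ≤ 1 - p + p * (1 - p ^ 2) ^ (j + 1) := by
    intro j
    induction j using Nat.twoStepInduction with
    | zero =>
      rw [minFailure_add_two, minFailure_zero, zero_add, pow_one]
      nlinarith [mul_nonneg (mul_nonneg hp0 hp0) (sub_nonneg.2 hp1)]
    | one =>
      rw [minFailure_add_two, minFailure_one]
      have h1 : (1 - p ^ 2) * edgeBound p = (1 - p) * (1 + p - 2 * p ^ 3 / (1 + p)) := by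
        unfold edgeBound; field_simp; ring
      have h2 : 1 - p + p * (1 - p ^ 2) ^ (1 + 1) - (1 - p) * (1 + p - 2 * p ^ 3 / (1 + p)) =
          (1 - p) * (p * (1 + 2 * p * (1 - p) - p ^ 3) * p) / (1 + p) := by
        field_simp; ring
      have h3 : 0 ≤ (1 - p) * (p * (1 + 2 * p * (1 - p) - p ^ 3) * p) / (1 + p) := by
        have : 0 ≤ 1 - p := by linarith
        have h4 : p ^ 3 ≤ 1 := pow_le_one₀ hp0 hp1
        have : 0 ≤ 1 + 2 * p * (1 - p) - p ^ 3 := by nlinarith [mul_nonneg hp0 this]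
        positivity
      rw [h1]; linarith
    | more j ih _ =>
      rw [minFailure_add_two]
      have hpow : (1 - p ^ 2) ^ (j + 2) ≤ (1 - p ^ 2) ^ 2 :=
        pow_le_pow_of_le_one hx hx1 (by omega)
      have h1 : p * (1 - p ^ 2) ^ 2 ≤ 1 - p := by
        have : p * (1 - p) * (1 + p) ^ 2 ≤ 1 := by
          nlinarith [sq_nonneg (2 * p - 1), sq_nonneg (p * p - p), sq_nonneg (p * p + p - 1),
            mul_nonneg hp0 (sub_nonneg.2 hp1)]
        nlinarith [mul_le_mul_of_nonneg_left this (sub_nonneg.2 hp1)]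
      have h2 : p * (1 - p ^ 2) ^ (j + 2) ≤ 1 - p :=
        (mul_le_mul_of_nonneg_left hpow hp0).trans h1
      calc (1 - p ^ 2) * minFailure p (j + 2) ≤
            (1 - p ^ 2) * (1 - p + p * (1 - p ^ 2) ^ (j + 1)) := mul_le_mul_of_nonneg_left ih hx
        _ = 1 - p + p * (1 - p ^ 2) ^ (j + 2 + 1) -
            p ^ 2 * (1 - p - p * (1 - p ^ 2) ^ (j + 2)) := by ring
        _ ≤ _ := by nlinarith [mul_nonneg (sq_nonneg p) (sub_nonneg.2 h2)]
  cases j with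
  | zero =>
    rw [zero_add, minFailure_one]; simpa using edgeBound_le_one hp0
  | succ j => exact key j

/-- Spending an edge on `st` is at least as good as any other use of it. -/
theorem mul_minFailure_le (hp0 : 0 ≤ p) (hp1 : p ≤ 1) (M : ℕ) :
    (1 - p) * minFailure p M ≤ minFailure p (M + 1) := by
  rcases Nat.even_or_odd' M with ⟨q, rfl | rfl⟩
  · have h := minFailure_two_mul_add (p := p) q 0
    rw [add_zero, minFailure_zero, mul_one] at h
    rw [minFailure_two_mul_add, minFailure_one, h, mul_comm]
    exact mul_le_mul_of_nonneg_left (one_sub_le_edgeBound hp0 hp1) (pow_nonneg (by nlinarith) _)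
  · have h := minFailure_add_two (p := p) 0
    rw [minFailure_zero, mul_one, zero_add] at h
    rw [add_assoc, minFailure_two_mul_add, minFailure_two_mul_add, minFailure_one, h,
      mul_left_comm]
    refine mul_le_mul_of_nonneg_left ?_ (pow_nonneg (by nlinarith) _)
    nlinarith [mul_le_mul_of_nonneg_left (edgeBound_le_one hp0) (sub_nonneg.2 hp1),
      mul_nonneg hp0 (sub_nonneg.2 hp1)]

end Optimum

/-! ### The extremal graphs -/

section Extremal

variable {V : Type*} [Fintype V] {G : TwoTerminalGraph V}

theorem not_isDiag_of_mem_innerEdges {e : Sym2 V} (he : e ∈ G.innerEdges) : ¬ e.IsDiag :=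
  SimpleGraph.not_isDiag_of_mem_edgeSet _ (mem_innerEdges.1 he).1

open scoped Classical in
theorem ncard_edgeSet : G.graph.edgeSet.ncard =
    (if G.graph.Adj G.s G.t then 1 else 0) + 2 * (G.sNbrs ∩ G.tNbrs).card +
      ((G.sNbrs ∪ G.tNbrs).card - (G.sNbrs ∩ G.tNbrs).card + G.innerEdges.card) := by
  rw [← SimpleGraph.coe_edgeFinset, Set.ncard_coe_finset, card_edgeFinset]
  have h1 := Finset.card_union_add_card_inter G.sNbrs G.tNbrs
  have h2 : (G.sNbrs ∩ G.tNbrs).card ≤ (G.sNbrs ∪ G.tNbrs).card :=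
    Finset.card_le_card fun v hv => Finset.mem_union_left _ (Finset.mem_inter.1 hv).1
  omega

theorem minFailure_le_one_sub_reliability {m : ℕ} (hm : G.graph.edgeSet.ncard = m + 1) {ρ : ℝ}
    (hρ0 : 0 ≤ ρ) (hρ1 : ρ ≤ 1) : ρ * minFailure (1 - ρ) m ≤ 1 - G.reliability 3 ρ := by
  classical
  have hp0 : 0 ≤ 1 - ρ := by linarith
  have hp1 : 1 - ρ ≤ 1 := by linarith
  rw [one_sub_reliability]
  have h := le_failure (X := G.sNbrs) (Y := G.tNbrs) hp0 hp1 (minFailure (1 - ρ))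
    (minFailure_nonneg hp0 hp1)
    (minFailure_add_le hp0 hp1) (minFailure_le_one hp0 hp1) minFailure_one.le
    (minFailure_le_star hp0 hp1) fun e he => not_isDiag_of_mem_innerEdges (G := G) he
  rw [← minFailure_two_mul_add] at h
  rw [ncard_edgeSet] at hm
  split_ifs at hm ⊢ with hst
  · rw [show m = 2 * (G.sNbrs ∩ G.tNbrs).card + ((G.sNbrs ∪ G.tNbrs).card -
      (G.sNbrs ∩ G.tNbrs).card + G.innerEdges.card) by omega]
    exact mul_le_mul_of_nonneg_left h hρ0
  · rw [zero_add] at hm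
    rw [hm] at h
    have := mul_minFailure_le hp0 hp1 m
    rw [sub_sub_cancel] at this
    linarith

/-- The shape of the extremal graphs: the terminals are adjacent and have the same other neighbours,
two of which are `u` and `v`, and the only inner edge, if any, is `uv`; it is present when `P`
holds. -/
structure IsExtremal (G : TwoTerminalGraph V) (u v : V) (P : Prop) : Prop where
  adj : G.graph.Adj G.s G.t
  nbrs : G.sNbrs = G.tNbrs
  mem_left : u ∈ G.sNbrs
  mem_right : v ∈ G.sNbrs
  ne : u ≠ v
  inner : ∀ e, e ∈ G.innerEdges ↔ P ∧ e = s(u, v)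

theorem failure_singleton [DecidableEq V] {p : ℝ} (hp0 : 0 ≤ p) {X : Finset V} {u v : V}
    (hu : u ∈ X) (hv : v ∈ X) (huv : u ≠ v) :
    failure p X X {s(u, v)} = (1 - p ^ 2) ^ X.card * edgeBound p := by
  classical
  have hsum : ∀ a b, a ∈ X → b ∈ X → a ≠ b → ∑ σ : V → Fin 3, (∏ w, vertexWeight p X X w (σ w)) *
      (if σ a = 0 ∧ σ b = 2 then 1 else 0) = (p * (1 - p)) ^ 2 * (1 - p ^ 2) ^ (X.card - 2) := by
    intro a b ha hb hab
    let W : V → Fin 3 → ℝ := fun w i =>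
      if w = a then (if i = 0 then p * (1 - p) else 0) else
        if w = b then (if i = 2 then p * (1 - p) else 0) else vertexWeight p X X w i
    have h1 : ∀ σ : V → Fin 3, (∏ w, vertexWeight p X X w (σ w)) *
        (if σ a = 0 ∧ σ b = 2 then 1 else 0) = ∏ w, W w (σ w) := by
      intro σ
      split_ifs with h
      · rw [mul_one]
        refine Finset.prod_congr rfl fun w _ => ?_
        simp only [W]
        split_ifs with h1 h2 h2 h3
        · rw [h1, h.1]; simp [vertexWeight, ha]
        · exact absurd (h1 ▸ h.1) h2
        · rw [h2, h.2]; simp [vertexWeight, hb]; ring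
        · exact absurd (h2 ▸ h.2) h3
        · rfl
      · rw [mul_zero, eq_comm]
        by_cases h0 : σ a = 0
        · have h2 : σ b ≠ 2 := fun h2 => h ⟨h0, h2⟩
          exact Finset.prod_eq_zero (Finset.mem_univ b) (by simp [W, hab.symm, h2])
        · exact Finset.prod_eq_zero (Finset.mem_univ a) (by simp [W, h0])
    have h2 : ∑ σ : V → Fin 3, ∏ w, W w (σ w) = ∏ w, ∑ i, W w i := by
      simp only [Finset.prod_univ_sum, Fintype.piFinset_univ]
    rw [Finset.sum_congr rfl fun σ _ => h1 σ, h2, ← Finset.mul_prod_erase _ _ (Finset.mem_univ a),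
      ← Finset.mul_prod_erase (Finset.univ.erase a) _ (Finset.mem_erase.2 ⟨hab.symm,
        Finset.mem_univ b⟩), ← mul_assoc]
    congr 1
    · simp [W, hab.symm]; ring
    · have hsub : (X.erase a).erase b ⊆ (Finset.univ.erase a).erase b :=
        Finset.erase_subset_erase _ (Finset.erase_subset_erase _ (Finset.subset_univ _))
      have hc : X.card - 2 = ((X.erase a).erase b).card := by
        rw [Finset.card_erase_of_mem (Finset.mem_erase.2 ⟨hab.symm, hb⟩),
          Finset.card_erase_of_mem ha]; omega
      rw [← Finset.prod_subset hsub, hc, ← Finset.prod_const]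
      · refine Finset.prod_congr rfl fun w hw => ?_
        simp only [Finset.mem_erase] at hw
        simp [W, hw.1, hw.2.1, vertexWeight, hw.2.2, Fin.sum_univ_three]; ring
      · intro w hw hw'
        simp only [Finset.mem_erase, Finset.mem_univ, and_true] at hw hw'
        have hwX : w ∉ X := fun h => hw' ⟨hw.1, hw.2, h⟩
        simp [W, hw.1, hw.2, vertexWeight, hwX, Fin.sum_univ_three]
  have hsplit : failure p X X {s(u, v)} = failure p X X ∅ -
      p * ((∑ σ : V → Fin 3, (∏ w, vertexWeight p X X w (σ w)) *
          (if σ u = 0 ∧ σ v = 2 then 1 else 0)) +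
        ∑ σ : V → Fin 3, (∏ w, vertexWeight p X X w (σ w)) *
          (if σ v = 0 ∧ σ u = 2 then 1 else 0)) := by
    unfold failure
    rw [← Finset.sum_add_distrib, Finset.mul_sum, ← Finset.sum_sub_distrib]
    refine Finset.sum_congr rfl fun σ _ => ?_
    simp only [stateWeight, Finset.prod_singleton, Finset.prod_empty, edgeFactor, cut_mk]
    by_cases h1 : σ u = 0 ∧ σ v = 2
    · simp [h1]; ring
    · by_cases h2 : σ v = 0 ∧ σ u = 2
      · simp [h2]; ring
      · simp [h1, h2]
  rw [hsplit, hsum u v hu hv huv, hsum v u hv hu huv.symm, failure_empty, Finset.inter_self]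
  obtain ⟨k, hk⟩ : ∃ k, X.card = k + 2 := Nat.exists_eq_add_of_le' (by
    have := Finset.card_le_card (Finset.insert_subset hu (Finset.singleton_subset_iff.2 hv))
    rwa [Finset.card_pair huv] at this)
  rw [hk, Nat.add_sub_cancel, pow_add, edgeBound]
  have : (1 - p ^ 2) ^ 2 * (1 - 2 * p ^ 3 / (1 + p) ^ 2) =
      (1 - p ^ 2) ^ 2 - 2 * p ^ 3 * (1 - p) ^ 2 := by
    have h1 : 1 + p ≠ 0 := by positivity
    field_simp; ring
  rw [mul_assoc ((1 - p ^ 2) ^ k), this]; ring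

namespace IsExtremal

variable {u v : V} {P : Prop}

theorem innerEdges_eq (h : IsExtremal G u v P) [Decidable P] :
    G.innerEdges = if P then {s(u, v)} else ∅ := by
  ext e
  rw [h.inner]
  split_ifs <;> simp [*]

theorem one_sub_reliability_eq (h : IsExtremal G u v P) {m : ℕ} (hm : G.sNbrs.card = m / 2)
    (hP : P ↔ Odd m) {ρ : ℝ} (hρ1 : ρ ≤ 1) :
    1 - G.reliability 3 ρ = ρ * minFailure (1 - ρ) m := by
  classical
  rw [one_sub_reliability, if_pos h.adj, ← h.nbrs, h.innerEdges_eq, minFailure, ← hm]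
  congr 1
  split_ifs with hp
  · rw [failure_singleton (by linarith) h.mem_left h.mem_right h.ne, Nat.odd_iff.1 (hP.1 hp),
      pow_one]
  · rw [failure_empty, Finset.inter_self,
      Nat.even_iff.1 (Nat.not_odd_iff_even.1 fun ho => hp (hP.2 ho)), pow_zero, mul_one]

theorem ncard_edgeSet_eq (h : IsExtremal G u v P) {m : ℕ} (hm : G.sNbrs.card = m / 2)
    (hP : P ↔ Odd m) : G.graph.edgeSet.ncard = m + 1 := by
  classical
  rw [ncard_edgeSet, if_pos h.adj, ← h.nbrs, h.innerEdges_eq, Finset.inter_self,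
    Finset.union_self, hm]
  split_ifs with hp
  · have := Nat.odd_iff.1 (hP.1 hp)
    rw [Finset.card_singleton]; omega
  · have := Nat.even_iff.1 (Nat.not_odd_iff_even.1 fun ho => hp (hP.2 ho))
    rw [Finset.card_empty]; omega

theorem adj_iff (h : IsExtremal G u v P) (a b : V) : G.graph.Adj a b ↔ a ≠ b ∧
    ((a = G.s ∧ (b = G.t ∨ b ∈ G.sNbrs)) ∨ (b = G.s ∧ (a = G.t ∨ a ∈ G.sNbrs)) ∨
      (a = G.t ∧ b ∈ G.sNbrs) ∨ (b = G.t ∧ a ∈ G.sNbrs) ∨ (P ∧ s(a, b) = s(u, v))) := by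
  have hs : ∀ w, w ∈ G.sNbrs → G.graph.Adj G.s w := fun w hw => (mem_sNbrs.1 hw).1
  have ht : ∀ w, w ∈ G.sNbrs → G.graph.Adj G.t w := fun w hw => by
    rw [h.nbrs] at hw; exact (mem_tNbrs.1 hw).1
  have hs' : ∀ w, G.graph.Adj G.s w → w = G.t ∨ w ∈ G.sNbrs := fun w hw => by
    rw [mem_sNbrs]; tauto
  have ht' : ∀ w, G.graph.Adj G.t w → w = G.s ∨ w ∈ G.sNbrs := fun w hw => by
    rw [h.nbrs, mem_tNbrs]; tauto
  constructor
  · intro hab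
    refine ⟨hab.ne, ?_⟩
    by_cases has : a = G.s
    · subst has; exact Or.inl ⟨rfl, hs' _ hab⟩
    by_cases hbs : b = G.s
    · subst hbs; exact Or.inr (Or.inl ⟨rfl, hs' _ hab.symm⟩)
    by_cases hat : a = G.t
    · subst hat; exact Or.inr (Or.inr (Or.inl ⟨rfl, (ht' _ hab).resolve_left hbs⟩))
    by_cases hbt : b = G.t
    · subst hbt; exact Or.inr (Or.inr (Or.inr (Or.inl ⟨rfl, (ht' _ hab.symm).resolve_left has⟩)))
    refine Or.inr (Or.inr (Or.inr (Or.inr ((h.inner _).1 (mem_innerEdges.2 ⟨hab, ?_, ?_⟩)))))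
    · simp only [Sym2.mem_iff, not_or]; exact ⟨Ne.symm has, Ne.symm hbs⟩
    · simp only [Sym2.mem_iff, not_or]; exact ⟨Ne.symm hat, Ne.symm hbt⟩
  · rintro ⟨-, ⟨rfl, rfl | hb⟩ | ⟨rfl, rfl | ha⟩ | ⟨rfl, hb⟩ | ⟨rfl, ha⟩ | ⟨hP, he⟩⟩
    · exact h.adj
    · exact hs _ hb
    · exact h.adj.symm
    · exact (hs _ ha).symm
    · exact ht _ hb
    · exact (ht _ ha).symm
    · exact (mem_innerEdges.1 ((h.inner _).2 ⟨hP, he⟩)).1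

open scoped Classical in
/-- A colouring of the vertices which determines an extremal graph: `s`, `t`, `u` and `v` have the
colours `0`, `1`, `2` and `3`, the other neighbours of the terminals have the colour `4`, and the
isolated vertices have the colour `5`. -/
noncomputable def colour (G : TwoTerminalGraph V) (u v : V) (a : V) : Fin 6 :=
  if a = G.s then 0 else if a = G.t then 1 else if a = u then 2 else if a = v then 3 else
    if a ∈ G.sNbrs then 4 else 5

theorem card_colour (h : IsExtremal G u v P) (k : Fin 6) :
    (Finset.univ.filter fun a => colour G u v a = k).card =
      if k = 4 then G.sNbrs.card - 2 else if k = 5 then Fintype.card V - (G.sNbrs.card + 2)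
        else 1 := by
  classical
  have hst := G.s_ne_t
  have hs : ∀ w ∈ G.sNbrs, w ≠ G.s ∧ w ≠ G.t := fun w hw =>
    ⟨(mem_sNbrs.1 hw).1.ne', (mem_sNbrs.1 hw).2⟩
  have hu := hs u h.mem_left
  have hv := hs v h.mem_right
  have huv := h.ne
  have hmu := h.mem_left
  have hmv := h.mem_right
  have h5 : ((insert G.s (insert G.t G.sNbrs))ᶜ).card =
      Fintype.card V - (G.sNbrs.card + 2) := by
    rw [Finset.card_compl, Finset.card_insert_of_notMem, Finset.card_insert_of_notMem]
    · exact fun h => (hs _ h).2 rfl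
    · rw [Finset.mem_insert, not_or]; exact ⟨hst, fun h => (hs _ h).1 rfl⟩
  have h4 : ((G.sNbrs.erase u).erase v).card = G.sNbrs.card - 2 := by
    rw [Finset.card_erase_of_mem (Finset.mem_erase.2 ⟨h.ne.symm, hmv⟩),
      Finset.card_erase_of_mem hmu]; omega
  have key : ∀ S : Finset V, (∀ a, colour G u v a = k ↔ a ∈ S) →
      (Finset.univ.filter fun a => colour G u v a = k).card = S.card := by
    intro S hS; congr 1; ext a; simp [hS]
  fin_cases k
  · rw [key {G.s} fun a => by unfold colour; split_ifs <;> simp_all]; rfl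
  · rw [key {G.t} fun a => by unfold colour; split_ifs <;> simp_all [eq_comm]]; rfl
  · rw [key {u} fun a => by unfold colour; split_ifs <;> simp_all [eq_comm]]; rfl
  · rw [key {v} fun a => by unfold colour; split_ifs <;> simp_all [eq_comm]]; rfl
  · rw [key ((G.sNbrs.erase u).erase v) fun a => by
      have := hs a; unfold colour; split_ifs <;> simp_all, h4]; rfl
  · rw [key (insert G.s (insert G.t G.sNbrs))ᶜ fun a => by
      unfold colour; split_ifs <;> simp_all, h5]; rfl

theorem colour_iff (h : IsExtremal G u v P) (a : V) :
    (colour G u v a = 0 ↔ a = G.s) ∧ (colour G u v a = 1 ↔ a = G.t) ∧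
      (colour G u v a = 2 ↔ a = u) ∧ (colour G u v a = 3 ↔ a = v) ∧
      ((colour G u v a = 2 ∨ colour G u v a = 3 ∨ colour G u v a = 4) ↔ a ∈ G.sNbrs) := by
  have hs : ∀ w ∈ G.sNbrs, w ≠ G.s ∧ w ≠ G.t := fun w hw =>
    ⟨(mem_sNbrs.1 hw).1.ne', (mem_sNbrs.1 hw).2⟩
  have hst := G.s_ne_t
  have hx := hs u h.mem_left
  have hy := hs v h.mem_right
  have hxy := h.ne
  have hmx := h.mem_left
  have hmy := h.mem_right
  have ha := hs a
  unfold colour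
  split_ifs <;> simp_all [eq_comm]

/-- Two extremal graphs of the same size are isomorphic: a bijection which preserves the colours is
an isomorphism. -/
theorem isomorphic {W : Type*} [Fintype W] {H : TwoTerminalGraph W} {u' v' : W}
    (h : IsExtremal G u v P) (h' : IsExtremal H u' v' P) (hX : G.sNbrs.card = H.sNbrs.card)
    (hV : Fintype.card V = Fintype.card W) : G.Isomorphic H := by
  classical
  have hfib : ∀ k, Nonempty ({a // colour G u v a = k} ≃ {a // colour H u' v' a = k}) := by
    intro k
    rw [← Fintype.card_eq, Fintype.card_subtype, Fintype.card_subtype, h.card_colour,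
      h'.card_colour, hX, hV]
  let φ : V ≃ W := Equiv.ofFiberEquiv fun k => (hfib k).some
  have hφ : ∀ a, colour H u' v' (φ a) = colour G u v a := fun a =>
    Equiv.ofFiberEquiv_map _ a
  have hs : ∀ a, φ a = H.s ↔ a = G.s := fun a => by
    rw [← (h'.colour_iff _).1, hφ, (h.colour_iff a).1]
  have ht : ∀ a, φ a = H.t ↔ a = G.t := fun a => by
    rw [← (h'.colour_iff _).2.1, hφ, (h.colour_iff a).2.1]
  have hu : ∀ a, φ a = u' ↔ a = u := fun a => by
    rw [← (h'.colour_iff _).2.2.1, hφ, (h.colour_iff a).2.2.1]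
  have hv : ∀ a, φ a = v' ↔ a = v := fun a => by
    rw [← (h'.colour_iff _).2.2.2.1, hφ, (h.colour_iff a).2.2.2.1]
  have hn : ∀ a, φ a ∈ H.sNbrs ↔ a ∈ G.sNbrs := fun a => by
    rw [← (h'.colour_iff _).2.2.2.2, hφ, (h.colour_iff a).2.2.2.2]
  refine ⟨⟨φ, ?_⟩, ?_⟩
  · intro a b
    rw [h.adj_iff, h'.adj_iff]
    simp only [Sym2.eq_iff, hs, ht, hu, hv, hn, φ.injective.ne_iff]
  · have h1 : φ G.s = H.s := (hs _).2 rfl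
    have h2 : φ G.t = H.t := (ht _).2 rfl
    simp [h1, h2]

end IsExtremal

end Extremal

/-! ### Uniqueness -/

section Uniqueness

variable {V : Type*} [Fintype V] {G : TwoTerminalGraph V}

/-- At `ρ = 1/2` the bound is attained only by the extremal graphs. -/
theorem exists_isExtremal {m : ℕ} (hm2 : 4 ≤ m) (hm : G.graph.edgeSet.ncard = m + 1)
    (hG : 1 - G.reliability 3 (1 / 2) ≤ 1 / 2 * minFailure (1 / 2) m) :
    ∃ u v, IsExtremal G u v (Odd m) ∧ G.sNbrs.card = m / 2 := by
  classical
  have hp0 : (0 : ℝ) ≤ 1 / 2 := by norm_num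
  have hp1 : (1 / 2 : ℝ) ≤ 1 := by norm_num
  have heb : edgeBound (1 / 2) = 8 / 9 := by norm_num [edgeBound]
  have hx : (1 - (1 / 2 : ℝ) ^ 2) = 3 / 4 := by norm_num
  have hd : ∀ e ∈ G.innerEdges, ¬ e.IsDiag := fun e he => not_isDiag_of_mem_innerEdges he
  rw [one_sub_reliability, show (1 - 1 / 2 : ℝ) = 1 / 2 by norm_num] at hG
  rw [ncard_edgeSet] at hm
  set c := (G.sNbrs ∩ G.tNbrs).card with hc
  set k := (G.sNbrs ∪ G.tNbrs).card - c + G.innerEdges.card with hk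
  -- The failure probability exceeds the bound if `st` is not an edge.
  have hst : G.graph.Adj G.s G.t := by
    by_contra hst
    rw [if_neg hst, zero_add] at hm
    rw [if_neg hst, one_mul] at hG
    have h := le_failure (X := G.sNbrs) (Y := G.tNbrs) hp0 hp1 (minFailure (1 / 2))
      (minFailure_nonneg hp0 hp1) (minFailure_add_le hp0 hp1) (minFailure_le_one hp0 hp1)
      minFailure_one.le (minFailure_le_star hp0 hp1) hd
    rw [← minFailure_two_mul_add, hm] at h
    have hle := h.trans hG
    have hpos : ∀ q : ℕ, (0 : ℝ) < (3 / 4) ^ q := fun q => by positivity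
    rcases Nat.even_or_odd' m with ⟨q, rfl | rfl⟩
    · have h0 := minFailure_two_mul_add (p := 1 / 2) q 0
      rw [add_zero, minFailure_zero, hx] at h0
      rw [minFailure_two_mul_add, minFailure_one, h0, heb, hx] at hle
      linarith [hpos q]
    · have h0 := minFailure_add_two (p := 1 / 2) 0
      rw [minFailure_zero, zero_add, hx] at h0
      rw [add_assoc, minFailure_two_mul_add, minFailure_two_mul_add, minFailure_one, heb, hx,
        h0] at hle
      linarith [hpos q]
  rw [if_pos hst] at hm hG
  have hmk : m = 2 * c + k := by omega
  have hG' : failure (1 / 2) G.sNbrs G.tNbrs G.innerEdges ≤ minFailure (1 / 2) m := by linarith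
  -- Every edge outside the paths of length `2` costs a factor `8/9`, and `(8/9)² > 3/4`.
  have hk1 : k ≤ 1 := by
    by_contra hk1
    have h := le_failure (X := G.sNbrs) (Y := G.tNbrs) hp0 hp1 (fun j => (8 / 9) ^ j)
      (fun j => by positivity) (fun a b => (pow_add _ a b).le)
      (fun a => pow_le_one₀ (by norm_num) (by norm_num))
      (by rw [pow_one, ← heb]; rfl)
      (fun j => by
        rw [hx]
        induction j with
        | zero => norm_num
        | succ j ih =>
          rcases j with _ | j
          · norm_num
          · have h34 : (3 / 4 : ℝ) ^ (j + 1) ≤ 3 / 4 := by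
              simpa using pow_le_pow_of_le_one (a := (3 / 4 : ℝ)) (by norm_num) (by norm_num)
                (show 1 ≤ j + 1 by omega)
            rw [pow_succ _ (j + 1 + 1), pow_succ (3 / 4 : ℝ) (j + 1)]
            linarith)
      hd
    rw [hx, ← hc, ← hk] at h
    have hle := h.trans hG'
    obtain ⟨i, r, hr, hir⟩ : ∃ i r, r < 2 ∧ k = 2 * (i + 1) + r :=
      ⟨k / 2 - 1, k % 2, Nat.mod_lt _ (by norm_num), by omega⟩
    have hmin : minFailure (1 / 2) m = (3 / 4) ^ c * ((3 / 4) ^ (i + 1) * (8 / 9) ^ r) := by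
      rw [hmk, hir, minFailure_two_mul_add, minFailure_two_mul_add, hx]
      interval_cases r
      · rw [minFailure_zero, pow_zero]
      · rw [minFailure_one, pow_one, heb]
    rw [hmin, hir] at hle
    have h1 : (3 / 4 : ℝ) ^ (i + 1) < ((8 / 9) ^ 2) ^ (i + 1) :=
      pow_lt_pow_left₀ (by norm_num) (by norm_num) (by omega)
    have h2 : (3 / 4 : ℝ) ^ (i + 1) * (8 / 9) ^ r < (8 / 9) ^ (2 * (i + 1) + r) := by
      rw [pow_add _ (2 * (i + 1)), pow_mul]
      exact mul_lt_mul_of_pos_right h1 (by positivity)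
    have h3 : (3 / 4 : ℝ) ^ c * ((3 / 4) ^ (i + 1) * (8 / 9) ^ r) <
        (3 / 4) ^ c * (8 / 9) ^ (2 * (i + 1) + r) := mul_lt_mul_of_pos_left h2 (by positivity)
    linarith
  have hcm : c = m / 2 := by omega
  -- With a single additional edge, that edge has to lower the failure probability.
  have hlt : k = 1 → failure (1 / 2) G.sNbrs G.tNbrs G.innerEdges < (3 / 4) ^ c := fun h1 => by
    rw [hmk, h1, minFailure_two_mul_add, minFailure_one, heb, hx] at hG'
    have : (0 : ℝ) < (3 / 4) ^ c := by positivity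
    linarith
  have hsub : G.sNbrs ∩ G.tNbrs ⊆ G.sNbrs ∪ G.tNbrs := fun v hv =>
    Finset.mem_union_left _ (Finset.mem_inter.1 hv).1
  have hcu : (G.sNbrs ∪ G.tNbrs).card ≤ c := by
    by_contra hcu
    have hk1' : k = 1 := by omega
    have hin : G.innerEdges = ∅ := Finset.card_eq_zero.1 (by omega)
    have := hlt hk1'
    rw [hin, failure_empty, hx] at this
    exact lt_irrefl _ this
  have heq := Finset.eq_of_subset_of_card_le hsub hcu
  have hXY : G.sNbrs = G.tNbrs := inf_eq_sup.1 heq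
  have hcX : G.sNbrs.card = c := by rw [hc, ← hXY, Finset.inter_self]
  have hkE : k = G.innerEdges.card := by rw [hk]; omega
  rcases Nat.lt_or_ge k 1 with hk0 | hk1'
  · obtain ⟨u, hu, v, hv, huv⟩ := Finset.one_lt_card.1 (show 1 < G.sNbrs.card by omega)
    have hin : G.innerEdges = ∅ := Finset.card_eq_zero.1 (by omega)
    have hodd : ¬ Odd m := by rw [Nat.odd_iff]; omega
    exact ⟨u, v, ⟨hst, hXY, hu, hv, huv, fun e => by simp [hin, hodd]⟩, by omega⟩
  · obtain ⟨e, he⟩ := Finset.card_eq_one.1 (show G.innerEdges.card = 1 by omega)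
    have hmem : ∀ w ∈ e, w ∈ G.sNbrs := by
      intro w hw
      by_contra hw'
      have h := failure_le_of_star (X := G.sNbrs) (Y := G.tNbrs) (E := ∅) hp0 hp1 (u := w)
        (D := {e}) (fun h => hw' (Finset.mem_inter.1 h).1)
        (fun e' he' => by
          rw [Finset.mem_singleton.1 he']
          exact ⟨hw, hd e (by simp [he])⟩) (Finset.disjoint_empty_left _)
      rw [if_neg (by rw [← hXY, Finset.union_self]; exact hw'), one_mul, Finset.empty_union,
        failure_empty, hx, ← he] at h
      exact absurd (hlt (by omega)) (not_lt.2 h)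
    have hde := hd e (by simp [he])
    induction e with | _ u v
    have hodd : Odd m := by rw [Nat.odd_iff]; omega
    exact ⟨u, v, ⟨hst, hXY, hmem u (by simp), hmem v (by simp), by simpa using hde,
      fun e => by simp [he, hodd]⟩, by omega⟩

end Uniqueness

/-! ### The graph `H n m` -/

section ExtremalGraph

theorem addIsolated_A_adj {k r n : ℕ} (hk : 3 ≤ k) (hkn : k ≤ n) (hr : r ≤ 1) (a b : Fin n) :
    ((A k r hk).addIsolated hkn).graph.Adj a b ↔ a ≠ b ∧ a.val < k ∧ b.val < k ∧
      (a.val ≤ 1 ∨ b.val ≤ 1 ∨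
        (r = 1 ∧ ((a.val = 2 ∧ b.val = 3) ∨ (a.val = 3 ∧ b.val = 2)))) := by
  simp only [addIsolated, A, SimpleGraph.map_adj, SimpleGraph.fromRel_adj]
  have hj : ∀ x y : ℕ, (x = 2 ∧ ∃ j : ℕ, 1 ≤ j ∧ j ≤ r ∧ y = 2 + j) ↔ x = 2 ∧ r = 1 ∧ y = 3 := by
    intro x y
    constructor
    · rintro ⟨h, j, h1, h2, h3⟩; omega
    · rintro ⟨h, h1, h2⟩; exact ⟨h, 1, by omega, by omega, by omega⟩
  simp only [hj]
  constructor
  · rintro ⟨x, y, ⟨hxy, h⟩, rfl, rfl⟩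
    have hxy' : x.val ≠ y.val := fun h => hxy (Fin.ext h)
    refine ⟨fun h => hxy ((Fin.castLEEmb hkn).injective h), x.isLt, y.isLt, ?_⟩
    simp only [Fin.castLEEmb_apply, Fin.val_castLE]
    omega
  · rintro ⟨hab, ha, hb, h⟩
    refine ⟨⟨a, ha⟩, ⟨b, hb⟩, ⟨fun h => hab (Fin.ext (by simpa using h)), ?_⟩, rfl, rfl⟩
    simp only
    omega

theorem isExtremal_addIsolated_A {k r n : ℕ} (hk : 4 ≤ k) (hkn : k ≤ n) (hr : r ≤ 1) :
    IsExtremal ((A k r (by omega)).addIsolated hkn) ⟨2, by omega⟩ ⟨3, by omega⟩ (r = 1) ∧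
      ((A k r (by omega)).addIsolated hkn).sNbrs.card = k - 2 := by
  have hk3 : 3 ≤ k := by omega
  have hs : ((A k r hk3).addIsolated hkn).s.val = 0 := rfl
  have ht : ((A k r hk3).addIsolated hkn).t.val = 1 := rfl
  have hX : ∀ a : Fin n, a ∈ ((A k r hk3).addIsolated hkn).sNbrs ↔ 2 ≤ a.val ∧ a.val < k := by
    intro a
    simp only [mem_sNbrs, addIsolated_A_adj hk3 hkn hr, ne_eq, Fin.ext_iff, hs, ht]
    omega
  have hY : ∀ a : Fin n, a ∈ ((A k r hk3).addIsolated hkn).tNbrs ↔ 2 ≤ a.val ∧ a.val < k := by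
    intro a
    simp only [mem_tNbrs, addIsolated_A_adj hk3 hkn hr, ne_eq, Fin.ext_iff, hs, ht]
    omega
  refine ⟨⟨?_, ?_, ?_, ?_, ?_, ?_⟩, ?_⟩
  · simp only [addIsolated_A_adj hk3 hkn hr, ne_eq, Fin.ext_iff, hs, ht]; omega
  · ext a; rw [hX, hY]
  · rw [hX]; simp only; omega
  · rw [hX]; simp only; omega
  · simp
  · intro e
    induction e with | _ a b
    simp only [mem_innerEdges, SimpleGraph.mem_edgeSet, addIsolated_A_adj hk3 hkn hr, Sym2.mem_iff,
      Sym2.eq_iff, ne_eq, Fin.ext_iff, hs, ht]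
    omega
  · have : (((A k r hk3).addIsolated hkn).sNbrs.map Fin.valEmbedding) = Finset.Ico 2 k := by
      ext i
      simp only [Finset.mem_map, hX, Fin.valEmbedding_apply, Finset.mem_Ico]
      constructor
      · rintro ⟨a, ha, rfl⟩; exact ha
      · exact fun h => ⟨⟨i, by omega⟩, h, rfl⟩
    rw [← Finset.card_map Fin.valEmbedding, this, Nat.card_Ico]

theorem exists_isExtremal_H {n m : ℕ} (hm : 5 ≤ m + 1) (hmn : m + 1 + 3 ≤ 2 * n) :
    ∃ u v, IsExtremal (H n (m + 1) hm hmn) u v (Odd m) ∧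
      (H n (m + 1) hm hmn).sNbrs.card = m / 2 := by
  unfold H
  split_ifs with h
  · have hodd : Odd m := by rw [Nat.odd_iff]; rw [Nat.even_iff] at h; omega
    obtain ⟨h1, h2⟩ := isExtremal_addIsolated_A (k := (m + 1 + 2) / 2) (r := 1) (n := n)
      (by rw [Nat.even_iff] at h; omega) (by omega) le_rfl
    have hP : (1 = 1) = Odd m := by simp [hodd]
    exact ⟨_, _, hP ▸ h1, h2.trans (by rw [Nat.even_iff] at h; omega)⟩
  · have hodd : ¬ Odd m := by rw [Nat.odd_iff]; rw [Nat.even_iff] at h; omega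
    obtain ⟨h1, h2⟩ := isExtremal_addIsolated_A (k := (m + 1 + 3) / 2) (r := 0) (n := n)
      (by omega) (by omega) zero_le_one
    have hP : (0 = 1) = Odd m := by simp [hodd]
    exact ⟨_, _, hP ▸ h1, h2.trans (by rw [Nat.even_iff] at h; omega)⟩

end ExtremalGraph

end TwoTerminalGraph

theorem mainTheorem1 (n m : ℕ) (hn : 6 ≤ n) (hm : 5 ≤ m) (hmn : m + 3 ≤ 2 * n) :
    TwoTerminalGraph.IsUMRTTG 3 n m (TwoTerminalGraph.H n m hm hmn) ∧
      ∀ G : TwoTerminalGraph (Fin n), TwoTerminalGraph.IsUMRTTG 3 n m G →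
        G.Isomorphic (TwoTerminalGraph.H n m hm hmn) := by
  obtain ⟨m, rfl⟩ : ∃ k, m = k + 1 := ⟨m - 1, by omega⟩
  obtain ⟨u, v, hH, hc⟩ := TwoTerminalGraph.exists_isExtremal_H hm hmn
  have hHT : TwoTerminalGraph.H n (m + 1) hm hmn ∈ TwoTerminalGraph.T n (m + 1) :=
    hH.ncard_edgeSet_eq hc Iff.rfl
  refine ⟨⟨hHT, fun G hG ρ hρ => ?_⟩, fun G hG => ?_⟩
  · have h1 := TwoTerminalGraph.minFailure_le_one_sub_reliability hG hρ.1 hρ.2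
    have h2 := hH.one_sub_reliability_eq hc Iff.rfl hρ.2
    linarith
  · have h1 := hG.2 _ hHT (1 / 2) (by norm_num)
    have h2 := hH.one_sub_reliability_eq hc Iff.rfl (ρ := 1 / 2) (by norm_num)
    rw [show (1 - 1 / 2 : ℝ) = 1 / 2 by norm_num] at h2
    obtain ⟨u', v', hG', hc'⟩ := TwoTerminalGraph.exists_isExtremal (by omega) hG.1
      (by linarith)
    exact hG'.isomorphic hH (hc'.trans hc.symm) rfl
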